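/- Let $K$ be a field of characteristic $0$ and let $A$ be a nonzero unital associative (possibly non-commutative) $K$-algebra. Let $(L,\omega)$ be an $A$-anchored Lie algebra, that is, a Lie algebra $L$ over $K$ together with a Lie algebra morphism $\omega:L\to\mathrm{Der}_K(A)$. Let $U(L)$ be the universal enveloping algebra with its usual bialgebra structure ($\Delta(X)=X\otimes1+1\otimes X$, $\varepsilon(X)=0$ for $X\in L$), acting on $A$ by the extension of $\omega$. Let $\mathcal B=A\odot U(L)\odot A$ be the Connes–Moscovici $A$-bialgebroid: the vector space $A\otimes U(L)\otimes A$ with unit $1\otimes1\otimes1$, product $$(a\otimes u\otimes b)(a'\otimes v\otimes b')=\sum a(u_{(1)}\cdot a')\otimes u_{(2)}v\otimes(u_{(3)}\cdot b')b,$$ source $s(a)=a\otimes1\otimes1$, target $t(a^{op})=1\otimes1\otimes a$, counit $\varepsilon(a\otimes u\otimes b)=a\,\varepsilon(u)\,b$ and comultiplication $\Delta(a\otimes u\otimes b)=\sum(a\otimes u_{(1)}\otimes1)\otimes_A(1\otimes u_{(2)}\otimes b)$ with values in $\mathcal B\otimes_A\mathcal B=(\mathcal B\otimes\mathcal B)/\langle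 t(a^{op})m\otimes n-m\otimes s(a)n\rangle$. Let $\mathrm{Prim}(\mathcal B)=\{x\in\mathcal B\mid\Delta(x)=x\otimes_A1+1\otimes_Ax\}$, an $A$-anchored Lie algebra with the commutator bracket and anchor $\omega_{\mathcal B}(x)(a)=\varepsilon(x\,t(a^{op}))$. Let $\langle s-t\rangle=\{s(a)-t(a^{op})\mid a\in A\}$, which is a Lie ideal of $\mathrm{Prim}(\mathcal B)$, with the restricted anchor. Let $\delta:L\to\mathrm{Der}_K(\langle s-t\rangle)$ be given by $\delta(X)=[1\otimes X\otimes1,-]$, and let $L\ltimes_\delta\langle s-t\rangle$ be the semi-direct product, i.e. the vector space $L\times\langle s-t\rangle$ with bracket $[(X,y),(X',y')]=([X,X'],\delta(X)(y')-\delta(X')(y)+[y,y'])$ and anchor $(X,y)\mapsto\omega(X)+\omega_{\mathcal B}(y)$. Then the map $$L\ltimes_\delta\langle s-t\rangle\longrightarrow\mathrm{Prim}\big(A\odot U(L)\odot A\big),\qquad(X,y)\longmapsto1\otimes X\otimes1+y,$$ is an isomorphism of $A$-anchored Lie algebras, i.e. an isomorphism of Lie algebras compatible with the anchors. -/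

import Mathlib

open scoped TensorProduct
open MulOpposite (op)

attribute [local instance 100] LieRing.ofAssociativeRing

/-! ### Derivations and anchored Lie algebras -/

section Anchored

/-- The Lie algebra `Der_K(A)` of `K`-linear derivations of a (possibly noncommutative) algebra. -/
def DerK (K A : Type*) [Field K] [Ring A] [Algebra K A] : LieSubalgebra K (Module.End K A) where
  carrier := {d | ∀ a b : A, d (a * b) = d a * b + a * d b}
  add_mem' := by
    intro d e hd he a b
    simp only [LinearMap.add_apply, hd a b, he a b, add_mul, mul_add]
    abel
  zero_mem' := by intro a b; simp
  smul_mem' := by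
    intro c d hd a b
    simp only [LinearMap.smul_apply, hd a b, smul_add, smul_mul_assoc, mul_smul_comm]
  lie_mem' := by
    intro d e hd he a b
    have hd' : ∀ a b : A, d (a * b) = d a * b + a * d b := hd
    have he' : ∀ a b : A, e (a * b) = e a * b + a * e b := he
    simp only [LieRing.of_associative_ring_bracket, LinearMap.sub_apply, Module.End.mul_apply,
      hd', he', map_add, sub_mul, mul_sub]
    abel

variable {K A : Type*} [Field K] [Ring A] [Algebra K A]

/-- The map `δ : P → Der_K(I)`, `x ↦ [x, -]`, for a Lie ideal `I` of a Lie algebra `P`. -/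
def idealAd {P : Type*} [LieRing P] [LieAlgebra K P] (I : LieIdeal K P) :
    P →ₗ⁅K⁆ LieDerivation K I I where
  toFun x :=
    { toFun := fun y => ⟨⁅x, (y : P)⁆, lie_mem_right K P I x y y.2⟩
      map_add' := fun y z => Subtype.ext (lie_add x (y : P) (z : P))
      map_smul' := fun c y => Subtype.ext (lie_smul c x (y : P))
      leibniz' := fun y z => Subtype.ext (by
        change ⁅x, ⁅(y : P), (z : P)⁆⁆ = ⁅(y : P), ⁅x, (z : P)⁆⁆ - ⁅(z : P), ⁅x, (y : P)⁆⁆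
        rw [leibniz_lie x (y : P) (z : P), ← lie_skew (z : P) ⁅x, (y : P)⁆]
        abel) }
  map_add' x x' := by ext y; exact add_lie x x' (y : P)
  map_smul' c x := by ext y; exact smul_lie c x (y : P)
  map_lie' {x x'} := by
    ext y
    change ⁅⁅x, x'⁆, (y : P)⁆ = ⁅x, ⁅x', (y : P)⁆⁆ - ⁅x', ⁅x, (y : P)⁆⁆
    exact lie_lie x x' (y : P)

/-- The anchor `(X'', X') ↦ ω''(X'') + ω'(X')` of the semi-direct product `L'' ⋉_δ L'` of anchored
Lie algebras, where `[ω''(X''), ω'(X')] = ω'(δ(X'')(X'))`. -/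
def semidirectAnchor {L' L'' : Type*} [LieRing L'] [LieAlgebra K L'] [LieRing L'']
    [LieAlgebra K L''] (δ : L'' →ₗ⁅K⁆ LieDerivation K L' L') (ω'' : L'' →ₗ⁅K⁆ DerK K A)
    (ω' : L' →ₗ⁅K⁆ DerK K A) (h : ∀ x y, ⁅ω'' x, ω' y⁆ = ω' (δ x y)) :
    LieAlgebra.SemiDirectSum L' L'' δ →ₗ⁅K⁆ DerK K A where
  toFun z := ω'' z.right + ω' z.left
  map_add' z w := by simp only [LieAlgebra.SemiDirectSum.add_eq_mk, map_add]; abel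
  map_smul' c z := by simp [LieAlgebra.SemiDirectSum.smul_eq_mk]
  map_lie' {z w} := by
    simp only [LieAlgebra.SemiDirectSum.lie_eq_mk, map_add, map_sub, LieHom.map_lie, add_lie,
      lie_add, ← h]
    rw [← lie_skew (ω' z.left) (ω'' w.right)]
    abel

end Anchored

/-! ### Left bialgebroids -/

section Bialgebroid

variable {K A B : Type*} [Field K] [Ring A] [Algebra K A] [Ring B] [Algebra K B]

/-- The subspace of `B ⊗_K B` spanned by the `t(a) m ⊗ n - m ⊗ s(a) n`. -/
def tensorRel (s : A →ₐ[K] B) (t : Aᵐᵒᵖ →ₐ[K] B) : Submodule K (B ⊗[K] B) :=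
  Submodule.span K {z | ∃ (a : A) (m n : B), z = (t (op a) * m) ⊗ₜ[K] n - m ⊗ₜ[K] (s a * n)}

/-- The tensor product `B ⊗_A B` of `A`-bimodules, `B` being a bimodule via `a·m·b = s(a) t(b) m`. -/
abbrev TensorA (s : A →ₐ[K] B) (t : Aᵐᵒᵖ →ₐ[K] B) : Type _ := (B ⊗[K] B) ⧸ tensorRel s t

/-- The subspace of `B ⊗_K B ⊗_K B` defining `B ⊗_A B ⊗_A B`. -/
def tensorRel₃ (s : A →ₐ[K] B) (t : Aᵐᵒᵖ →ₐ[K] B) : Submodule K (B ⊗[K] (B ⊗[K] B)) :=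
  Submodule.span K
    ({z | ∃ (a : A) (l m n : B),
        z = (t (op a) * l) ⊗ₜ[K] (m ⊗ₜ[K] n) - l ⊗ₜ[K] ((s a * m) ⊗ₜ[K] n)} ∪
      {z | ∃ (a : A) (l m n : B),
        z = l ⊗ₜ[K] ((t (op a) * m) ⊗ₜ[K] n) - l ⊗ₜ[K] (m ⊗ₜ[K] (s a * n))})

/-- `B ⊗_A B ⊗_A B`. -/
abbrev TensorA₃ (s : A →ₐ[K] B) (t : Aᵐᵒᵖ →ₐ[K] B) : Type _ :=
  (B ⊗[K] (B ⊗[K] B)) ⧸ tensorRel₃ s t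

/-- The canonical map `(B ⊗_A B) ⊗_K B → B ⊗_A B ⊗_A B`. -/
def tensorAssocLeft (s : A →ₐ[K] B) (t : Aᵐᵒᵖ →ₐ[K] B) :
    TensorA s t ⊗[K] B →ₗ[K] TensorA₃ s t :=
  TensorProduct.lift ((tensorRel s t).liftQ
    (TensorProduct.curry ((tensorRel₃ s t).mkQ ∘ₗ (TensorProduct.assoc K B B B).toLinearMap))
    (by
      refine Submodule.span_le.2 ?_
      rintro _ ⟨a, m, n, rfl⟩
      refine LinearMap.mem_ker.2 (LinearMap.ext fun p => ?_)
      simp only [map_sub, LinearMap.sub_apply, TensorProduct.curry_apply, LinearMap.comp_apply,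
        LinearEquiv.coe_coe, TensorProduct.assoc_tmul, LinearMap.zero_apply]
      rw [← map_sub, Submodule.mkQ_apply, Submodule.Quotient.mk_eq_zero]
      exact Submodule.subset_span (Or.inl ⟨a, m, n, p, rfl⟩)))

/-- The canonical map `B ⊗_K (B ⊗_A B) → B ⊗_A B ⊗_A B`. -/
def tensorAssocRight (s : A →ₐ[K] B) (t : Aᵐᵒᵖ →ₐ[K] B) :
    B ⊗[K] TensorA s t →ₗ[K] TensorA₃ s t :=
  TensorProduct.lift ((tensorRel s t).liftQ
    (TensorProduct.curry (tensorRel₃ s t).mkQ).flip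
    (by
      refine Submodule.span_le.2 ?_
      rintro _ ⟨a, m, n, rfl⟩
      refine LinearMap.mem_ker.2 (LinearMap.ext fun p => ?_)
      simp only [LinearMap.flip_apply, TensorProduct.curry_apply, LinearMap.zero_apply,
        TensorProduct.tmul_sub]
      rw [Submodule.mkQ_apply, Submodule.Quotient.mk_eq_zero]
      exact Submodule.subset_span (Or.inr ⟨a, p, m, n, rfl⟩))).flip

end Bialgebroid

/-- A left `A`-bialgebroid with total algebra `B`. An element of `B ⊗_A B` is handled through its
representatives in `B ⊗_K B`; none of the conditions depends on the representative. -/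
structure LeftBialgebroid (K A B : Type*) [Field K] [Ring A] [Algebra K A] [Ring B]
    [Algebra K B] where
  /-- the source map -/
  s : A →ₐ[K] B
  /-- the target map -/
  t : Aᵐᵒᵖ →ₐ[K] B
  commute : ∀ (a : A) (b : Aᵐᵒᵖ), s a * t b = t b * s a
  /-- the comultiplication `Δ : B → B ⊗_A B` -/
  Δ : B →ₗ[K] TensorA s t
  /-- the counit `ε : B → A` -/
  ε : B →ₗ[K] A
  /-- `Δ` is `A`-bilinear: `Δ(s(a) t(b) x) = ∑ s(a) x₁ ⊗ t(b) x₂`. -/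
  Δ_bilin : ∀ (a b : A) (x : B) (z : B ⊗[K] B), (tensorRel s t).mkQ z = Δ x →
    Δ (s a * t (op b) * x) = (tensorRel s t).mkQ ((s a ⊗ₜ[K] t (op b)) * z)
  /-- `ε` is `A`-bilinear. -/
  ε_bilin : ∀ (a b : A) (x : B), ε (s a * t (op b) * x) = a * ε x * b
  coassoc : ∀ (x : B) (z : B ⊗[K] B), (tensorRel s t).mkQ z = Δ x →
    tensorAssocLeft s t (Δ.rTensor B z) = tensorAssocRight s t (Δ.lTensor B z)
  /-- `∑ s(ε(x₁)) x₂ = x` -/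
  counit_left : ∀ (x : B) (z : B ⊗[K] B), (tensorRel s t).mkQ z = Δ x →
    LinearMap.mul' K B ((s.toLinearMap ∘ₗ ε).rTensor B z) = x
  /-- `∑ t(ε(x₂)) x₁ = x` -/
  counit_right : ∀ (x : B) (z : B ⊗[K] B), (tensorRel s t).mkQ z = Δ x →
    LinearMap.mul' K B (TensorProduct.comm K B B
      ((t.toLinearMap ∘ₗ (MulOpposite.opLinearEquiv K).toLinearMap ∘ₗ ε).lTensor B z)) = x
  /-- `Δ` takes values in the Takeuchi product: `∑ x₁ t(a) ⊗ x₂ = ∑ x₁ ⊗ x₂ s(a)`. -/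
  takeuchi : ∀ (x : B) (z : B ⊗[K] B), (tensorRel s t).mkQ z = Δ x → ∀ a : A,
    (tensorRel s t).mkQ (z * (t (op a) ⊗ₜ[K] 1)) = (tensorRel s t).mkQ (z * (1 ⊗ₜ[K] s a))
  Δ_one : Δ 1 = (tensorRel s t).mkQ (1 ⊗ₜ[K] 1)
  /-- `Δ` is multiplicative for the componentwise product. -/
  Δ_mul : ∀ (x y : B) (z w : B ⊗[K] B), (tensorRel s t).mkQ z = Δ x →
    (tensorRel s t).mkQ w = Δ y → Δ (x * y) = (tensorRel s t).mkQ (z * w)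
  ε_mul_s : ∀ x y : B, ε (x * s (ε y)) = ε (x * y)
  ε_mul_t : ∀ x y : B, ε (x * t (op (ε y))) = ε (x * y)
  ε_one : ε 1 = 1

namespace LeftBialgebroid

variable {K A B : Type*} [Field K] [Ring A] [Algebra K A] [Ring B] [Algebra K B]
variable (𝓑 : LeftBialgebroid K A B)

theorem mkQ_rel (a : A) (m n : B) :
    (tensorRel 𝓑.s 𝓑.t).mkQ ((𝓑.t (op a) * m) ⊗ₜ[K] n) =
      (tensorRel 𝓑.s 𝓑.t).mkQ (m ⊗ₜ[K] (𝓑.s a * n)) := by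
  rw [← sub_eq_zero, ← map_sub, Submodule.mkQ_apply, Submodule.Quotient.mk_eq_zero]
  exact Submodule.subset_span ⟨a, m, n, rfl⟩

theorem ε_s_mul (a : A) (x : B) : 𝓑.ε (𝓑.s a * x) = a * 𝓑.ε x := by
  simpa using 𝓑.ε_bilin a 1 x

theorem ε_t_mul (a : A) (x : B) : 𝓑.ε (𝓑.t (op a) * x) = 𝓑.ε x * a := by
  simpa using 𝓑.ε_bilin 1 a x

theorem ε_s (a : A) : 𝓑.ε (𝓑.s a) = a := by
  simpa [𝓑.ε_one] using 𝓑.ε_s_mul a 1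

theorem ε_t (a : A) : 𝓑.ε (𝓑.t (op a)) = a := by
  simpa [𝓑.ε_one] using 𝓑.ε_t_mul a 1

theorem ε_mul_s_eq (x : B) (a : A) : 𝓑.ε (x * 𝓑.t (op a)) = 𝓑.ε (x * 𝓑.s a) := by
  have := 𝓑.ε_mul_t x (𝓑.s a)
  rwa [𝓑.ε_s] at this

theorem Δ_s (a : A) : 𝓑.Δ (𝓑.s a) = (tensorRel 𝓑.s 𝓑.t).mkQ (𝓑.s a ⊗ₜ[K] 1) := by
  simpa using 𝓑.Δ_bilin a 1 1 (1 ⊗ₜ[K] 1) 𝓑.Δ_one.symm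

theorem Δ_t (a : A) : 𝓑.Δ (𝓑.t (op a)) = (tensorRel 𝓑.s 𝓑.t).mkQ (1 ⊗ₜ[K] 𝓑.t (op a)) := by
  simpa using 𝓑.Δ_bilin 1 a 1 (1 ⊗ₜ[K] 1) 𝓑.Δ_one.symm

/-- The Lie algebra of primitive elements, with the commutator bracket. -/
def prim : LieSubalgebra K B where
  carrier := {x | 𝓑.Δ x = (tensorRel 𝓑.s 𝓑.t).mkQ (x ⊗ₜ[K] 1 + 1 ⊗ₜ[K] x)}
  add_mem' := by
    intro x y hx hy
    change 𝓑.Δ (x + y) = _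
    rw [map_add, hx, hy, ← map_add]
    congr 1
    rw [TensorProduct.add_tmul, TensorProduct.tmul_add]
    abel
  zero_mem' := by simp
  smul_mem' := by
    intro c x hx
    change 𝓑.Δ (c • x) = _
    rw [map_smul, hx, ← map_smul]
    congr 1
    rw [smul_add, TensorProduct.tmul_smul, TensorProduct.smul_tmul']
  lie_mem' := by
    intro x y hx hy
    change 𝓑.Δ ⁅x, y⁆ = _
    rw [LieRing.of_associative_ring_bracket, map_sub, 𝓑.Δ_mul x y _ _ hx.symm hy.symm,
      𝓑.Δ_mul y x _ _ hy.symm hx.symm, ← map_sub]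
    congr 1
    simp only [add_mul, mul_add, Algebra.TensorProduct.tmul_mul_tmul, one_mul, mul_one,
      TensorProduct.sub_tmul, TensorProduct.tmul_sub]
    abel

theorem mem_prim {x : B} :
    x ∈ 𝓑.prim ↔ 𝓑.Δ x = (tensorRel 𝓑.s 𝓑.t).mkQ (x ⊗ₜ[K] 1 + 1 ⊗ₜ[K] x) := Iff.rfl

theorem ε_prim {x : B} (hx : x ∈ 𝓑.prim) : 𝓑.ε x = 0 := by
  have h := 𝓑.counit_left x _ (𝓑.mem_prim.1 hx).symm
  simp only [map_add, LinearMap.rTensor_tmul, LinearMap.mul'_apply, LinearMap.comp_apply,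
    AlgHom.toLinearMap_apply, 𝓑.ε_one, map_one, one_mul, mul_one, add_eq_right] at h
  simpa [𝓑.ε_s] using congrArg 𝓑.ε h

/-- `x s(a) - s(a) x = s(ε(x s(a)))` for `x` primitive. -/
theorem prim_mul_s {x : B} (hx : x ∈ 𝓑.prim) (a : A) :
    x * 𝓑.s a = 𝓑.s a * x + 𝓑.s (𝓑.ε (x * 𝓑.s a)) := by
  let f : B ⊗[K] B →ₗ[K] B :=
    LinearMap.mul' K B ∘ₗ (𝓑.s.toLinearMap ∘ₗ 𝓑.ε).rTensor B
  have hf : tensorRel 𝓑.s 𝓑.t ≤ LinearMap.ker f := by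
    refine Submodule.span_le.2 ?_
    rintro _ ⟨a, m, n, rfl⟩
    simp [f, 𝓑.ε_t_mul, mul_assoc]
  have h := congrArg ((tensorRel 𝓑.s 𝓑.t).liftQ f hf)
    (𝓑.takeuchi x _ (𝓑.mem_prim.1 hx).symm a)
  simp only [Submodule.mkQ_apply, Submodule.liftQ_apply] at h
  simp only [f, add_mul, Algebra.TensorProduct.tmul_mul_tmul, one_mul, mul_one, map_add,
    LinearMap.comp_apply, LinearMap.rTensor_tmul, LinearMap.mul'_apply, AlgHom.toLinearMap_apply,
    𝓑.ε_t, 𝓑.ε_one, map_one, 𝓑.ε_prim hx, map_zero, zero_mul, zero_add, 𝓑.ε_mul_s_eq] at h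
  exact h.symm.trans (add_comm _ _)

/-- `x t(a) - t(a) x = t(ε(x s(a)))` for `x` primitive. -/
theorem prim_mul_t {x : B} (hx : x ∈ 𝓑.prim) (a : A) :
    x * 𝓑.t (op a) = 𝓑.t (op a) * x + 𝓑.t (op (𝓑.ε (x * 𝓑.s a))) := by
  let f : B ⊗[K] B →ₗ[K] B :=
    LinearMap.mul' K B ∘ₗ (TensorProduct.comm K B B).toLinearMap ∘ₗ
      (𝓑.t.toLinearMap ∘ₗ (MulOpposite.opLinearEquiv K).toLinearMap ∘ₗ 𝓑.ε).lTensor B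
  have hf : tensorRel 𝓑.s 𝓑.t ≤ LinearMap.ker f := by
    refine Submodule.span_le.2 ?_
    rintro _ ⟨a, m, n, rfl⟩
    simp [f, 𝓑.ε_s_mul, mul_assoc]
  have h := congrArg ((tensorRel 𝓑.s 𝓑.t).liftQ f hf)
    (𝓑.takeuchi x _ (𝓑.mem_prim.1 hx).symm a)
  simp only [Submodule.mkQ_apply, Submodule.liftQ_apply] at h
  simpa [f, add_mul, 𝓑.ε_s, 𝓑.ε_one, 𝓑.ε_prim hx] using h

/-- The anchor `ω_B(x)(a) = ε(x t(a))` of the Lie algebra of primitive elements. -/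
def primAnchor : 𝓑.prim →ₗ⁅K⁆ DerK K A where
  toFun x :=
    ⟨𝓑.ε ∘ₗ LinearMap.mulLeft K (x : B) ∘ₗ 𝓑.t.toLinearMap ∘ₗ
        (MulOpposite.opLinearEquiv K).toLinearMap, by
      intro a b
      change 𝓑.ε ((x : B) * 𝓑.t (op (a * b))) =
        𝓑.ε ((x : B) * 𝓑.t (op a)) * b + a * 𝓑.ε ((x : B) * 𝓑.t (op b))
      simp only [𝓑.ε_mul_s_eq, map_mul]
      have h := congrArg (fun y => 𝓑.ε (y * 𝓑.s b)) (𝓑.prim_mul_s x.2 a)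
      simp only [add_mul, map_add, mul_assoc, 𝓑.ε_s_mul, 𝓑.ε_s] at h
      rw [h, add_comm]⟩
  map_add' x y := by ext a; simp [add_mul]
  map_smul' c x := by ext a; simp
  map_lie' {x y} := by
    ext a
    change 𝓑.ε (((x : B) * y - y * x) * 𝓑.t (op a)) =
      𝓑.ε ((x : B) * 𝓑.t (op (𝓑.ε ((y : B) * 𝓑.t (op a))))) -
        𝓑.ε ((y : B) * 𝓑.t (op (𝓑.ε ((x : B) * 𝓑.t (op a)))))
    rw [𝓑.ε_mul_t, 𝓑.ε_mul_t, sub_mul, map_sub, mul_assoc, mul_assoc]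

theorem primAnchor_apply (x : 𝓑.prim) (a : A) :
    (𝓑.primAnchor x : Module.End K A) a = 𝓑.ε ((x : B) * 𝓑.t (op a)) := rfl

theorem s_sub_t_mem_prim (a : A) : 𝓑.s a - 𝓑.t (op a) ∈ 𝓑.prim := by
  rw [mem_prim, map_sub, 𝓑.Δ_s, 𝓑.Δ_t, TensorProduct.sub_tmul, TensorProduct.tmul_sub]
  have h := 𝓑.mkQ_rel a 1 1
  simp only [mul_one] at h
  simp only [map_add, map_sub, h]
  abel

/-- The ideal `⟨s - t⟩ = {s(a) - t(a) | a ∈ A}` of the Lie algebra of primitive elements. -/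
def stIdeal : LieIdeal K 𝓑.prim where
  carrier := {y | ∃ a : A, (y : B) = 𝓑.s a - 𝓑.t (op a)}
  add_mem' := by
    rintro y z ⟨a, ha⟩ ⟨b, hb⟩
    refine ⟨a + b, ?_⟩
    change (y : B) + (z : B) = _
    rw [ha, hb, MulOpposite.op_add, map_add, map_add]
    abel
  zero_mem' := ⟨0, by simp⟩
  smul_mem' := by
    rintro c y ⟨a, ha⟩
    exact ⟨c • a, by simp [ha, smul_sub]⟩
  lie_mem := by
    rintro x y ⟨a, ha⟩
    refine ⟨𝓑.ε ((x : B) * 𝓑.s a), ?_⟩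
    rw [LieSubalgebra.coe_bracket, LieRing.of_associative_ring_bracket, ha, mul_sub, sub_mul,
      sub_eq_of_eq_add' (𝓑.prim_mul_s x.2 a) |>.symm, sub_eq_of_eq_add' (𝓑.prim_mul_t x.2 a) |>.symm]
    abel

/-- The anchor of `⟨s - t⟩`: the restriction of the anchor of the primitive elements. -/
def stAnchor : 𝓑.stIdeal →ₗ⁅K⁆ DerK K A := 𝓑.primAnchor.comp 𝓑.stIdeal.incl

end LeftBialgebroid

/-! ### The bialgebra `U(L)` -/

section Enveloping

variable {K L : Type*} [Field K] [LieRing L] [LieAlgebra K L]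

/-- The Lie algebra map `L → U(L) ⊗ U(L)`, `X ↦ X ⊗ 1 + 1 ⊗ X`. -/
def ueaComulLie (K L : Type*) [Field K] [LieRing L] [LieAlgebra K L] :
    L →ₗ⁅K⁆ UniversalEnvelopingAlgebra K L ⊗[K] UniversalEnvelopingAlgebra K L where
  toFun X := UniversalEnvelopingAlgebra.ι K X ⊗ₜ[K] 1 + 1 ⊗ₜ[K] UniversalEnvelopingAlgebra.ι K X
  map_add' X Y := by
    rw [map_add, TensorProduct.add_tmul, TensorProduct.tmul_add]
    abel
  map_smul' c X := by
    rw [map_smul, RingHom.id_apply, smul_add, TensorProduct.tmul_smul, ← TensorProduct.smul_tmul']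
  map_lie' {X Y} := by
    simp only [LieHom.map_lie, LieRing.of_associative_ring_bracket, add_mul, mul_add,
      Algebra.TensorProduct.tmul_mul_tmul, one_mul, mul_one, TensorProduct.sub_tmul,
      TensorProduct.tmul_sub]
    abel

/-- The comultiplication of `U(L)`: the algebra map with `Δ(X) = X ⊗ 1 + 1 ⊗ X` for `X ∈ L`. -/
def ueaComul (K L : Type*) [Field K] [LieRing L] [LieAlgebra K L] :
    UniversalEnvelopingAlgebra K L →ₐ[K]
      UniversalEnvelopingAlgebra K L ⊗[K] UniversalEnvelopingAlgebra K L :=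
  UniversalEnvelopingAlgebra.lift K (ueaComulLie K L)

/-- The counit of `U(L)`: the algebra map vanishing on `L`. -/
def ueaCounit (K L : Type*) [Field K] [LieRing L] [LieAlgebra K L] :
    UniversalEnvelopingAlgebra K L →ₐ[K] K :=
  UniversalEnvelopingAlgebra.lift K 0

theorem ueaComul_ι (X : L) : ueaComul K L (UniversalEnvelopingAlgebra.ι K X) =
    UniversalEnvelopingAlgebra.ι K X ⊗ₜ[K] 1 + 1 ⊗ₜ[K] UniversalEnvelopingAlgebra.ι K X :=
  UniversalEnvelopingAlgebra.lift_ι_apply K (ueaComulLie K L) X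

theorem ueaCounit_ι (X : L) : ueaCounit K L (UniversalEnvelopingAlgebra.ι K X) = 0 :=
  UniversalEnvelopingAlgebra.lift_ι_apply K (0 : L →ₗ⁅K⁆ K) X

theorem uea_hom_ext {C : Type*} [Ring C] [Algebra K C]
    {f g : UniversalEnvelopingAlgebra K L →ₐ[K] C}
    (h : ∀ X : L, f (UniversalEnvelopingAlgebra.ι K X) = g (UniversalEnvelopingAlgebra.ι K X)) :
    f = g :=
  UniversalEnvelopingAlgebra.hom_ext K (LieHom.ext h)

instance ueaBialgebra (K L : Type*) [Field K] [LieRing L] [LieAlgebra K L] :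
    Bialgebra K (UniversalEnvelopingAlgebra K L) :=
  Bialgebra.ofAlgHom (ueaComul K L) (ueaCounit K L)
    (uea_hom_ext fun X => by
      simp [-UniversalEnvelopingAlgebra.ι_apply, ueaComul_ι, TensorProduct.add_tmul,
        TensorProduct.tmul_add, Algebra.TensorProduct.one_def, add_assoc])
    (uea_hom_ext fun X => by
      simp [-UniversalEnvelopingAlgebra.ι_apply, ueaComul_ι, ueaCounit_ι])
    (uea_hom_ext fun X => by
      simp [-UniversalEnvelopingAlgebra.ι_apply, ueaComul_ι, ueaCounit_ι])

theorem uea_comul_ι (X : L) : Coalgebra.comul (R := K) (UniversalEnvelopingAlgebra.ι K X) =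
    UniversalEnvelopingAlgebra.ι K X ⊗ₜ[K] 1 + 1 ⊗ₜ[K] UniversalEnvelopingAlgebra.ι K X :=
  ueaComul_ι X

theorem uea_counit_ι (X : L) :
    Coalgebra.counit (R := K) (UniversalEnvelopingAlgebra.ι K X) = 0 :=
  ueaCounit_ι X

/-- `U(L)` is generated as an algebra by `L`. -/
theorem uea_mem_subalgebra (S : Subalgebra K (UniversalEnvelopingAlgebra K L))
    (hS : ∀ X : L, UniversalEnvelopingAlgebra.ι K X ∈ S) (u : UniversalEnvelopingAlgebra K L) :
    u ∈ S := by
  let f : L →ₗ⁅K⁆ S :=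
    { toFun := fun X => ⟨UniversalEnvelopingAlgebra.ι K X, hS X⟩
      map_add' := fun X Y => Subtype.ext (map_add _ X Y)
      map_smul' := fun c X => Subtype.ext (map_smul _ c X)
      map_lie' := fun {X Y} => Subtype.ext (LieHom.map_lie _ X Y) }
  have h : S.val.comp (UniversalEnvelopingAlgebra.lift K f) = AlgHom.id K _ :=
    uea_hom_ext fun X => by
      rw [AlgHom.comp_apply, UniversalEnvelopingAlgebra.lift_ι_apply]
      rfl
  have := DFunLike.congr_fun h u
  rw [AlgHom.comp_apply, AlgHom.id_apply] at this
  rw [← this]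
  exact (UniversalEnvelopingAlgebra.lift K f u).2

end Enveloping

/-! ### The Connes-Moscovici bialgebroid `A ⊙ U(L) ⊙ A` -/

section ConnesMoscovici

variable {K A L : Type*} [Field K] [Ring A] [Algebra K A] [LieRing L] [LieAlgebra K L]
variable (ω : L →ₗ⁅K⁆ DerK K A)

/-- The action of `U(L)` on `A` extending the anchor. -/
def anchorAct : UniversalEnvelopingAlgebra K L →ₐ[K] Module.End K A :=
  UniversalEnvelopingAlgebra.lift K ((DerK K A).incl.comp ω)

theorem anchorAct_ι (X : L) :
    anchorAct ω (UniversalEnvelopingAlgebra.ι K X) = (ω X : Module.End K A) :=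
  UniversalEnvelopingAlgebra.lift_ι_apply K ((DerK K A).incl.comp ω) X

/-- The diagonal action of `U(L)` on `A ⊗ U(L) ⊗ A`:
`u · (a ⊗ v ⊗ b) = ∑ (u₁ · a) ⊗ u₂ v ⊗ (u₃ · b)`. -/
def cmAct : UniversalEnvelopingAlgebra K L →ₐ[K]
    Module.End K (A ⊗[K] (UniversalEnvelopingAlgebra K L ⊗[K] A)) :=
  Module.endTensorEndAlgHom.comp
    ((Algebra.TensorProduct.map (anchorAct ω)
      (Module.endTensorEndAlgHom.comp
        ((Algebra.TensorProduct.map (Algebra.lmul K (UniversalEnvelopingAlgebra K L))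
          (anchorAct ω)).comp
          (Bialgebra.comulAlgHom K (UniversalEnvelopingAlgebra K L))))).comp
      (Bialgebra.comulAlgHom K (UniversalEnvelopingAlgebra K L)))

theorem cmAct_ι (X : L) (a : A) (u : UniversalEnvelopingAlgebra K L) (b : A) :
    cmAct ω (UniversalEnvelopingAlgebra.ι K X) (a ⊗ₜ[K] (u ⊗ₜ[K] b)) =
      (ω X : Module.End K A) a ⊗ₜ[K] (u ⊗ₜ[K] b) +
      a ⊗ₜ[K] ((UniversalEnvelopingAlgebra.ι K X * u) ⊗ₜ[K] b) +
      a ⊗ₜ[K] (u ⊗ₜ[K] (ω X : Module.End K A) b) := by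
  simp only [cmAct, AlgHom.comp_apply, Bialgebra.comulAlgHom_apply, uea_comul_ι, map_add,
    Algebra.TensorProduct.map_tmul, map_one, anchorAct_ι, Module.endTensorEndAlgHom_apply,
    LinearMap.add_apply, TensorProduct.AlgebraTensorModule.map_tmul, Module.End.one_apply,
    TensorProduct.tmul_add]
  simp [add_assoc]

/-- The linear map `a' ⊗ v ⊗ b' ↦ a a' ⊗ v ⊗ b' b`. -/
def cmBimod (U : Type*) [Ring U] [Algebra K U] (a b : A) : Module.End K (A ⊗[K] (U ⊗[K] A)) :=
  TensorProduct.map (LinearMap.mulLeft K a)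
    (TensorProduct.map LinearMap.id (LinearMap.mulRight K b))

theorem cmBimod_tmul (U : Type*) [Ring U] [Algebra K U] (a b a' b' : A) (u : U) :
    cmBimod (K := K) U a b (a' ⊗ₜ[K] (u ⊗ₜ[K] b')) = (a * a') ⊗ₜ[K] (u ⊗ₜ[K] (b' * b)) := rfl

/-- The product of `A ⊙ U(L) ⊙ A`:
`(a ⊗ u ⊗ b) (a' ⊗ v ⊗ b') = ∑ a (u₁ · a') ⊗ u₂ v ⊗ (u₃ · b') b`. -/
def cmMul : A ⊗[K] (UniversalEnvelopingAlgebra K L ⊗[K] A) →ₗ[K]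
    Module.End K (A ⊗[K] (UniversalEnvelopingAlgebra K L ⊗[K] A)) :=
  TensorProduct.lift (LinearMap.mk₂ K
    (fun a w => TensorProduct.lift (LinearMap.mk₂ K
      (fun u b => cmBimod (UniversalEnvelopingAlgebra K L) a b * cmAct ω u)
      (fun u v b => by rw [map_add, mul_add])
      (fun c u b => by rw [map_smul, mul_smul_comm])
      (fun u b b' => by
        rw [← add_mul]; congr 1; ext; simp [cmBimod_tmul, mul_add, TensorProduct.tmul_add])
      (fun c u b => by
        rw [← smul_mul_assoc]; congr 1; ext; simp [cmBimod_tmul])) w)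
    (fun a a' w => by
      induction w using TensorProduct.induction_on with
      | zero => simp
      | tmul u b =>
        simp only [TensorProduct.lift.tmul, LinearMap.mk₂_apply]
        rw [← add_mul]; congr 1; ext; simp [cmBimod_tmul, add_mul, TensorProduct.add_tmul]
      | add x y hx hy => simp only [map_add, hx, hy]; abel)
    (fun c a w => by
      induction w using TensorProduct.induction_on with
      | zero => simp
      | tmul u b =>
        simp only [TensorProduct.lift.tmul, LinearMap.mk₂_apply]
        rw [← smul_mul_assoc]; congr 1; ext; simp [cmBimod_tmul, TensorProduct.smul_tmul']
      | add x y hx hy => simp only [map_add, hx, hy, smul_add])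
    (fun a w w' => map_add _ w w')
    (fun c a w => map_smul _ c w))

theorem cmMul_tmul (a b : A) (u : UniversalEnvelopingAlgebra K L) :
    cmMul ω (a ⊗ₜ[K] (u ⊗ₜ[K] b)) =
      cmBimod (UniversalEnvelopingAlgebra K L) a b * cmAct ω u := rfl

/-- Two linear maps out of `A ⊗ U ⊗ A` agree if they agree on pure tensors. -/
theorem cm_ext {U V : Type*} [Ring U] [Algebra K U] [AddCommGroup V] [Module K V]
    {f g : A ⊗[K] (U ⊗[K] A) →ₗ[K] V}
    (h : ∀ a u b, f (a ⊗ₜ[K] (u ⊗ₜ[K] b)) = g (a ⊗ₜ[K] (u ⊗ₜ[K] b))) : f = g := by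
  ext a u b
  exact h a u b

theorem cmBimod_mul (U : Type*) [Ring U] [Algebra K U] (a b a' b' : A) :
    cmBimod (K := K) U a b * cmBimod U a' b' = cmBimod U (a * a') (b' * b) :=
  cm_ext fun c u d => by simp [cmBimod_tmul, Module.End.mul_apply, mul_assoc]

theorem cmMul_bimod (a b : A) (y : A ⊗[K] (UniversalEnvelopingAlgebra K L ⊗[K] A)) :
    cmMul ω (cmBimod _ a b y) = cmBimod _ a b * cmMul ω y := by
  have h : cmMul ω ∘ₗ cmBimod _ a b =
      LinearMap.mulLeft K (cmBimod (UniversalEnvelopingAlgebra K L) a b) ∘ₗ cmMul ω :=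
    cm_ext fun c u d => by
      simp only [LinearMap.comp_apply, cmBimod_tmul, cmMul_tmul, LinearMap.mulLeft_apply]
      rw [← mul_assoc, cmBimod_mul]
  exact DFunLike.congr_fun h y

theorem der_apply (X : L) (a b : A) : (ω X : Module.End K A) (a * b) =
    (ω X : Module.End K A) a * b + a * (ω X : Module.End K A) b := (ω X).2 a b

theorem cmAct_bimod (X : L) (a b : A) :
    cmAct ω (UniversalEnvelopingAlgebra.ι K X) * cmBimod _ a b =
      cmBimod _ ((ω X : Module.End K A) a) b +
      cmBimod _ a b * cmAct ω (UniversalEnvelopingAlgebra.ι K X) +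
      cmBimod _ a ((ω X : Module.End K A) b) :=
  cm_ext fun c u d => by
    simp only [Module.End.mul_apply, LinearMap.add_apply, cmBimod_tmul, cmAct_ι, der_apply,
      TensorProduct.add_tmul, TensorProduct.tmul_add, map_add]
    abel

theorem cmMul_act (u : UniversalEnvelopingAlgebra K L)
    (y : A ⊗[K] (UniversalEnvelopingAlgebra K L ⊗[K] A)) :
    cmMul ω (cmAct ω u y) = cmAct ω u * cmMul ω y := by
  let S : Subalgebra K (UniversalEnvelopingAlgebra K L) :=
    { carrier := {u | ∀ y, cmMul ω (cmAct ω u y) = cmAct ω u * cmMul ω y}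
      mul_mem' := by
        intro u v hu hv y
        rw [map_mul, Module.End.mul_apply, hu, hv, mul_assoc]
      add_mem' := by
        intro u v hu hv y
        rw [map_add, LinearMap.add_apply, map_add, hu, hv, add_mul]
      algebraMap_mem' := by
        intro c y
        rw [AlgHom.commutes, Module.algebraMap_end_apply, map_smul, Algebra.smul_def] }
  refine uea_mem_subalgebra S (fun X y => ?_) u y
  have h : cmMul ω ∘ₗ cmAct ω (UniversalEnvelopingAlgebra.ι K X) =
      LinearMap.mulLeft K (cmAct ω (UniversalEnvelopingAlgebra.ι K X)) ∘ₗ cmMul ω :=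
    cm_ext fun c u d => by
      simp only [LinearMap.comp_apply, cmAct_ι, map_add, cmMul_tmul, LinearMap.mulLeft_apply,
        map_mul]
      rw [← mul_assoc, ← mul_assoc, cmAct_bimod, add_mul, add_mul]
  exact DFunLike.congr_fun h y

theorem cmMul_assoc (x y : A ⊗[K] (UniversalEnvelopingAlgebra K L ⊗[K] A)) :
    cmMul ω (cmMul ω x y) = cmMul ω x * cmMul ω y := by
  have h : cmMul ω ∘ₗ (cmMul ω).flip y = LinearMap.mulRight K (cmMul ω y) ∘ₗ cmMul ω :=
    cm_ext fun a u b => by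
      simp only [LinearMap.comp_apply, LinearMap.flip_apply, cmMul_tmul, LinearMap.mulRight_apply,
        Module.End.mul_apply]
      rw [cmMul_bimod, cmMul_act, mul_assoc]
  exact DFunLike.congr_fun h x

/-- The total algebra `A ⊗ U(L) ⊗ A` of the Connes-Moscovici bialgebroid of the anchored Lie
algebra `(L, ω)`. -/
def CM (_ω : L →ₗ⁅K⁆ DerK K A) : Type _ := A ⊗[K] (UniversalEnvelopingAlgebra K L ⊗[K] A)

instance : AddCommGroup (CM ω) :=
  inferInstanceAs (AddCommGroup (A ⊗[K] (UniversalEnvelopingAlgebra K L ⊗[K] A)))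

instance : Module K (CM ω) :=
  inferInstanceAs (Module K (A ⊗[K] (UniversalEnvelopingAlgebra K L ⊗[K] A)))

/-- The identification of `A ⊗ U(L) ⊗ A` with its type synonym `CM ω`. -/
def toCM : A ⊗[K] (UniversalEnvelopingAlgebra K L ⊗[K] A) ≃ₗ[K] CM ω :=
  LinearEquiv.refl K (A ⊗[K] (UniversalEnvelopingAlgebra K L ⊗[K] A))

/-- The element `a ⊗ u ⊗ b`. -/
def cmElem (a : A) (u : UniversalEnvelopingAlgebra K L) (b : A) : CM ω :=
  toCM ω (a ⊗ₜ[K] (u ⊗ₜ[K] b))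

theorem cm_one_mul (x : A ⊗[K] (UniversalEnvelopingAlgebra K L ⊗[K] A)) :
    cmMul ω (1 ⊗ₜ[K] (1 ⊗ₜ[K] 1)) x = x := by
  rw [cmMul_tmul, map_one, mul_one]
  have h : cmBimod (K := K) (UniversalEnvelopingAlgebra K L) (1 : A) 1 = LinearMap.id :=
    cm_ext fun a u b => by simp [cmBimod_tmul]
  rw [h]
  rfl

theorem der_one (X : L) : (ω X : Module.End K A) 1 = 0 := by
  have := der_apply ω X 1 1
  simpa using this

theorem cmAct_one (u : UniversalEnvelopingAlgebra K L) :
    cmAct ω u (1 ⊗ₜ[K] (1 ⊗ₜ[K] 1)) = 1 ⊗ₜ[K] (u ⊗ₜ[K] 1) := by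
  let S : Subalgebra K (UniversalEnvelopingAlgebra K L) :=
    { carrier := {u | ∀ v, cmAct ω u (1 ⊗ₜ[K] (v ⊗ₜ[K] 1)) = 1 ⊗ₜ[K] ((u * v) ⊗ₜ[K] 1)}
      mul_mem' := by
        intro u u' hu hu' v
        rw [map_mul, Module.End.mul_apply, hu', hu, mul_assoc]
      add_mem' := by
        intro u u' hu hu' v
        rw [map_add, LinearMap.add_apply, hu, hu', add_mul, TensorProduct.add_tmul,
          TensorProduct.tmul_add]
      algebraMap_mem' := by
        intro c v
        rw [AlgHom.commutes, Module.algebraMap_end_apply, ← Algebra.smul_def,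
          ← TensorProduct.smul_tmul', TensorProduct.tmul_smul] }
  have := uea_mem_subalgebra S (fun X v => by simp [-UniversalEnvelopingAlgebra.ι_apply, cmAct_ι, der_one]) u 1
  simpa using this

theorem cm_mul_one (x : A ⊗[K] (UniversalEnvelopingAlgebra K L ⊗[K] A)) :
    cmMul ω x (1 ⊗ₜ[K] (1 ⊗ₜ[K] 1)) = x := by
  have h : (cmMul ω).flip (1 ⊗ₜ[K] (1 ⊗ₜ[K] 1)) = LinearMap.id :=
    cm_ext fun a u b => by
      simp [cmMul_tmul, Module.End.mul_apply, cmAct_one, cmBimod_tmul]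
  exact DFunLike.congr_fun h x

instance : Ring (CM ω) where
  __ := (inferInstance : AddCommGroup (CM ω))
  mul x y := toCM ω (cmMul ω ((toCM ω).symm x) ((toCM ω).symm y))
  one := cmElem ω 1 1 1
  left_distrib x y z := map_add (cmMul ω x) y z
  right_distrib x y z := LinearMap.map_add₂ (cmMul ω) x y z
  zero_mul x := LinearMap.map_zero₂ (cmMul ω) x
  mul_zero x := map_zero (cmMul ω x)
  mul_assoc x y z := DFunLike.congr_fun (cmMul_assoc ω x y) z
  one_mul := cm_one_mul ω
  mul_one := cm_mul_one ω

instance : Algebra K (CM ω) :=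
  Algebra.ofModule (fun c x y => LinearMap.map_smul₂ (cmMul ω) c x y)
    (fun c x y => map_smul (cmMul ω x) c y)

theorem cmElem_mul (a b : A) (u : UniversalEnvelopingAlgebra K L) (y : CM ω) :
    cmElem ω a u b * y = toCM ω (cmBimod _ a b (cmAct ω u ((toCM ω).symm y))) := rfl

theorem cmElem_one_mul (a b a' b' : A) (u : UniversalEnvelopingAlgebra K L) :
    cmElem ω a 1 b * cmElem ω a' u b' = cmElem ω (a * a') u (b' * b) := by
  rw [cmElem_mul, map_one]
  rfl

theorem cm_ext' {V : Type*} [AddCommGroup V] [Module K V] {f g : CM ω →ₗ[K] V}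
    (h : ∀ a u b, f (cmElem ω a u b) = g (cmElem ω a u b)) : f = g :=
  cm_ext (f := f ∘ₗ (toCM ω).toLinearMap) (g := g ∘ₗ (toCM ω).toLinearMap) h |> fun h' =>
    LinearMap.ext fun x => DFunLike.congr_fun h' ((toCM ω).symm x)

/-- The map `u ↦ a ⊗ u ⊗ b`. -/
def cmMid (a b : A) : UniversalEnvelopingAlgebra K L →ₗ[K] CM ω :=
  (toCM ω).toLinearMap ∘ₗ (TensorProduct.mk K A (UniversalEnvelopingAlgebra K L ⊗[K] A) a) ∘ₗ
    (TensorProduct.mk K (UniversalEnvelopingAlgebra K L) A).flip b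

theorem cmMid_apply (a b : A) (u : UniversalEnvelopingAlgebra K L) :
    cmMid ω a b u = cmElem ω a u b := rfl

/-- The source map `a ↦ a ⊗ 1 ⊗ 1`. -/
def cmS : A →ₐ[K] CM ω :=
  AlgHom.ofLinearMap
    ((toCM ω).toLinearMap ∘ₗ
      (TensorProduct.mk K A (UniversalEnvelopingAlgebra K L ⊗[K] A)).flip (1 ⊗ₜ[K] 1)) rfl
    (fun a b => by
      change cmElem ω (a * b) 1 1 = cmElem ω a 1 1 * cmElem ω b 1 1
      rw [cmElem_one_mul, one_mul])

theorem cmS_apply (a : A) : cmS ω a = cmElem ω a 1 1 := rfl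

/-- The target map `a ↦ 1 ⊗ 1 ⊗ a`. -/
def cmT : Aᵐᵒᵖ →ₐ[K] CM ω :=
  AlgHom.ofLinearMap
    ((toCM ω).toLinearMap ∘ₗ (TensorProduct.mk K A (UniversalEnvelopingAlgebra K L ⊗[K] A) 1) ∘ₗ
      (TensorProduct.mk K (UniversalEnvelopingAlgebra K L) A 1) ∘ₗ
        (MulOpposite.opLinearEquiv K).symm.toLinearMap) rfl
    (fun a b => by
      change cmElem ω 1 1 (b.unop * a.unop) = cmElem ω 1 1 a.unop * cmElem ω 1 1 b.unop
      rw [cmElem_one_mul, one_mul])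

theorem cmT_apply (a : A) : cmT ω (op a) = cmElem ω 1 1 a := rfl

/-- A representative of the comultiplication in `B ⊗_K B`:
`a ⊗ u ⊗ b ↦ ∑ (a ⊗ u₁ ⊗ 1) ⊗ (1 ⊗ u₂ ⊗ b)`. -/
def cmDRep : CM ω →ₗ[K] CM ω ⊗[K] CM ω :=
  (TensorProduct.map
      ((toCM ω).toLinearMap ∘ₗ
        ((TensorProduct.mk K (UniversalEnvelopingAlgebra K L) A).flip 1).lTensor A)
      ((toCM ω).toLinearMap ∘ₗ TensorProduct.mk K A (UniversalEnvelopingAlgebra K L ⊗[K] A) 1)) ∘ₗ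
    (TensorProduct.assoc K A (UniversalEnvelopingAlgebra K L)
      (UniversalEnvelopingAlgebra K L ⊗[K] A)).symm.toLinearMap ∘ₗ
    (((TensorProduct.assoc K (UniversalEnvelopingAlgebra K L) (UniversalEnvelopingAlgebra K L)
      A).toLinearMap ∘ₗ (Coalgebra.comul (R := K)).rTensor A).lTensor A) ∘ₗ
    (toCM ω).symm.toLinearMap

theorem cmDRep_elem (a b : A) (u : UniversalEnvelopingAlgebra K L) :
    cmDRep ω (cmElem ω a u b) =
      TensorProduct.map (cmMid ω a 1) (cmMid ω 1 b) (Coalgebra.comul (R := K) u) := by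
  have h : ∀ v : UniversalEnvelopingAlgebra K L ⊗[K] UniversalEnvelopingAlgebra K L,
      (TensorProduct.map
        ((toCM ω).toLinearMap ∘ₗ
          ((TensorProduct.mk K (UniversalEnvelopingAlgebra K L) A).flip 1).lTensor A)
        ((toCM ω).toLinearMap ∘ₗ TensorProduct.mk K A (UniversalEnvelopingAlgebra K L ⊗[K] A) 1))
        ((TensorProduct.assoc K A (UniversalEnvelopingAlgebra K L)
          (UniversalEnvelopingAlgebra K L ⊗[K] A)).symm
          (a ⊗ₜ[K] (TensorProduct.assoc K (UniversalEnvelopingAlgebra K L)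
            (UniversalEnvelopingAlgebra K L) A (v ⊗ₜ[K] b)))) =
      TensorProduct.map (cmMid ω a 1) (cmMid ω 1 b) v := by
    intro v
    induction v using TensorProduct.induction_on with
    | zero => simp
    | tmul p q => rfl
    | add x y hx hy => simp only [TensorProduct.add_tmul, TensorProduct.tmul_add, map_add, hx, hy]
  exact h _

/-- The counit `a ⊗ u ⊗ b ↦ a ε(u) b`. -/
def cmε : CM ω →ₗ[K] A :=
  LinearMap.mul' K A ∘ₗ
    ((TensorProduct.lid K A).toLinearMap ∘ₗ (Coalgebra.counit (R := K)).rTensor A).lTensor A ∘ₗ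
      (toCM ω).symm.toLinearMap

theorem cmε_elem (a b : A) (u : UniversalEnvelopingAlgebra K L) :
    cmε ω (cmElem ω a u b) = a * (Coalgebra.counit (R := K) u • b) := rfl

/-- The comultiplication `a ⊗ u ⊗ b ↦ ∑ (a ⊗ u₁ ⊗ 1) ⊗_A (1 ⊗ u₂ ⊗ b)`. -/
def cmΔ : CM ω →ₗ[K] TensorA (cmS ω) (cmT ω) :=
  (tensorRel (cmS ω) (cmT ω)).mkQ ∘ₗ cmDRep ω

/-! #### Verification of the bialgebroid axioms -/

theorem tensorRel_mem {B : Type*} [Ring B] [Algebra K B] (s : A →ₐ[K] B) (t : Aᵐᵒᵖ →ₐ[K] B)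
    (a : A) (m n : B) :
    (t (op a) * m) ⊗ₜ[K] n - m ⊗ₜ[K] (s a * n) ∈ tensorRel s t :=
  Submodule.subset_span ⟨a, m, n, rfl⟩

theorem tensorRel_mul_right {B : Type*} [Ring B] [Algebra K B] (s : A →ₐ[K] B)
    (t : Aᵐᵒᵖ →ₐ[K] B) {z : B ⊗[K] B} (hz : z ∈ tensorRel s t) (w : B ⊗[K] B) :
    z * w ∈ tensorRel s t := by
  induction w using TensorProduct.induction_on with
  | zero => simp
  | add x y hx hy => rw [mul_add]; exact add_mem hx hy
  | tmul p q =>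
    have h : tensorRel s t ≤ (tensorRel s t).comap (LinearMap.mulRight K (p ⊗ₜ[K] q)) := by
      refine Submodule.span_le.2 ?_
      rintro _ ⟨a, m, n, rfl⟩
      rw [SetLike.mem_coe, Submodule.mem_comap, LinearMap.mulRight_apply]
      simp only [sub_mul, Algebra.TensorProduct.tmul_mul_tmul, mul_assoc]
      exact tensorRel_mem s t a _ _
    exact h hz

theorem cm_commute (a : A) (b : Aᵐᵒᵖ) : cmS ω a * cmT ω b = cmT ω b * cmS ω a := by
  induction b using MulOpposite.rec'
  rename_i b
  rw [cmS_apply, cmT_apply, cmElem_one_mul, cmElem_one_mul]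
  simp

theorem cm_rel_left (a b : A) {z : CM ω ⊗[K] CM ω} (hz : z ∈ tensorRel (cmS ω) (cmT ω)) :
    (cmS ω a ⊗ₜ[K] cmT ω (op b)) * z ∈ tensorRel (cmS ω) (cmT ω) := by
  have h : tensorRel (cmS ω) (cmT ω) ≤ (tensorRel (cmS ω) (cmT ω)).comap
      (LinearMap.mulLeft K (cmS ω a ⊗ₜ[K] cmT ω (op b))) := by
    refine Submodule.span_le.2 ?_
    rintro _ ⟨c, m, n, rfl⟩
    rw [SetLike.mem_coe, Submodule.mem_comap, LinearMap.mulLeft_apply]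
    simp only [mul_sub, Algebra.TensorProduct.tmul_mul_tmul, ← mul_assoc]
    rw [cm_commute, ← cm_commute ω c (op b), mul_assoc, mul_assoc (cmS ω c)]
    exact tensorRel_mem _ _ c _ _
  exact h hz

theorem cmDRep_bilin (a b : A) (x : CM ω) :
    cmDRep ω (cmS ω a * cmT ω (op b) * x) = (cmS ω a ⊗ₜ[K] cmT ω (op b)) * cmDRep ω x := by
  have h : cmDRep ω ∘ₗ LinearMap.mulLeft K (cmS ω a * cmT ω (op b)) =
      LinearMap.mulLeft K (cmS ω a ⊗ₜ[K] cmT ω (op b)) ∘ₗ cmDRep ω := by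
    refine cm_ext' ω fun c u d => ?_
    simp only [LinearMap.comp_apply, LinearMap.mulLeft_apply, cmS_apply, cmT_apply,
      cmElem_one_mul, cmDRep_elem, mul_one]
    generalize Coalgebra.comul (R := K) u = v
    induction v using TensorProduct.induction_on with
    | zero => simp
    | tmul p q =>
      simp only [TensorProduct.map_tmul, Algebra.TensorProduct.tmul_mul_tmul, cmMid_apply,
        cmElem_one_mul, mul_one]
    | add x y hx hy => simp only [map_add, mul_add, hx, hy]
  exact DFunLike.congr_fun h x

/-- The algebra map `u ↦ 1 ⊗ u ⊗ 1`. -/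
def cmJ : UniversalEnvelopingAlgebra K L →ₐ[K] CM ω :=
  AlgHom.ofLinearMap (cmMid ω 1 1) rfl
    (fun u v => by
      change cmElem ω 1 (u * v) 1 = cmElem ω 1 u 1 * cmElem ω 1 v 1
      have h : cmElem ω 1 v 1 = toCM ω (cmAct ω v (1 ⊗ₜ[K] (1 ⊗ₜ[K] 1))) := by
        rw [cmAct_one, cmElem]
      rw [h, cmElem_mul, LinearEquiv.symm_apply_apply, ← Module.End.mul_apply (cmAct ω u),
        ← map_mul, cmAct_one, cmBimod_tmul, one_mul, cmElem])

theorem cmJ_apply (u : UniversalEnvelopingAlgebra K L) : cmJ ω u = cmElem ω 1 u 1 := rfl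

theorem cmElem_eq (a b : A) (u : UniversalEnvelopingAlgebra K L) :
    cmElem ω a u b = cmS ω a * cmT ω (op b) * cmJ ω u := by
  rw [cmS_apply, cmT_apply, cmJ_apply, cmElem_one_mul, cmElem_one_mul]
  simp

theorem cmJ_ι_mul (X : L) (a b : A) (u : UniversalEnvelopingAlgebra K L) :
    cmJ ω (UniversalEnvelopingAlgebra.ι K X) * cmElem ω a u b =
      cmElem ω ((ω X : Module.End K A) a) u b +
      cmElem ω a (UniversalEnvelopingAlgebra.ι K X * u) b +
      cmElem ω a u ((ω X : Module.End K A) b) := by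
  rw [cmJ_apply, cmElem_mul]
  simp only [cmElem, LinearEquiv.symm_apply_apply, cmAct_ι, map_add, cmBimod_tmul, one_mul,
    mul_one]

theorem cmElem_zero_left (u : UniversalEnvelopingAlgebra K L) (b : A) : cmElem ω 0 u b = 0 := by
  rw [cmElem, TensorProduct.zero_tmul, map_zero]

theorem cmElem_zero_right (a : A) (u : UniversalEnvelopingAlgebra K L) : cmElem ω a u 0 = 0 := by
  rw [cmElem, TensorProduct.tmul_zero, TensorProduct.tmul_zero, map_zero]

theorem cmJ_ι_mul_s (X : L) (a : A) :
    cmJ ω (UniversalEnvelopingAlgebra.ι K X) * cmS ω a =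
      cmS ω a * cmJ ω (UniversalEnvelopingAlgebra.ι K X) +
        cmS ω ((ω X : Module.End K A) a) := by
  rw [cmS_apply, cmJ_ι_mul, der_one, cmElem_zero_right, cmJ_apply, cmElem_one_mul, cmS_apply]
  simp only [mul_one, add_zero]
  exact add_comm _ _

theorem cmJ_ι_mul_t (X : L) (a : A) :
    cmJ ω (UniversalEnvelopingAlgebra.ι K X) * cmT ω (op a) =
      cmT ω (op a) * cmJ ω (UniversalEnvelopingAlgebra.ι K X) +
        cmT ω (op ((ω X : Module.End K A) a)) := by
  rw [cmT_apply, cmJ_ι_mul, der_one, cmElem_zero_left, cmJ_apply, cmElem_one_mul, cmT_apply]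
  simp only [mul_one, one_mul, zero_add]

/-- The algebra map `u ↦ ∑ (1 ⊗ u₁ ⊗ 1) ⊗ (1 ⊗ u₂ ⊗ 1)`. -/
def cmE : UniversalEnvelopingAlgebra K L →ₐ[K] CM ω ⊗[K] CM ω :=
  (Algebra.TensorProduct.map (cmJ ω) (cmJ ω)).comp
    (Bialgebra.comulAlgHom K (UniversalEnvelopingAlgebra K L))

theorem cmE_ι (X : L) : cmE ω (UniversalEnvelopingAlgebra.ι K X) =
    cmJ ω (UniversalEnvelopingAlgebra.ι K X) ⊗ₜ[K] 1 +
      1 ⊗ₜ[K] cmJ ω (UniversalEnvelopingAlgebra.ι K X) := by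
  simp [-UniversalEnvelopingAlgebra.ι_apply, cmE, uea_comul_ι]

theorem cmDRep_J (u : UniversalEnvelopingAlgebra K L) : cmDRep ω (cmJ ω u) = cmE ω u :=
  cmDRep_elem ω 1 1 u

theorem cmE_rel (u : UniversalEnvelopingAlgebra K L) {z : CM ω ⊗[K] CM ω}
    (hz : z ∈ tensorRel (cmS ω) (cmT ω)) : cmE ω u * z ∈ tensorRel (cmS ω) (cmT ω) := by
  let S : Subalgebra K (UniversalEnvelopingAlgebra K L) :=
    { carrier := {u | ∀ z ∈ tensorRel (cmS ω) (cmT ω), cmE ω u * z ∈ tensorRel (cmS ω) (cmT ω)}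
      mul_mem' := by
        intro u v hu hv z hz
        rw [map_mul, mul_assoc]
        exact hu _ (hv _ hz)
      add_mem' := by
        intro u v hu hv z hz
        rw [map_add, add_mul]
        exact add_mem (hu _ hz) (hv _ hz)
      algebraMap_mem' := by
        intro c z hz
        rw [AlgHom.commutes, ← Algebra.smul_def]
        exact Submodule.smul_mem _ c hz }
  refine uea_mem_subalgebra S (fun X z hz => ?_) u z hz
  have h : tensorRel (cmS ω) (cmT ω) ≤ (tensorRel (cmS ω) (cmT ω)).comap
      (LinearMap.mulLeft K (cmE ω (UniversalEnvelopingAlgebra.ι K X))) := by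
    refine Submodule.span_le.2 ?_
    rintro _ ⟨c, m, n, rfl⟩
    rw [SetLike.mem_coe, Submodule.mem_comap, LinearMap.mulLeft_apply, cmE_ι]
    simp only [mul_sub, add_mul, Algebra.TensorProduct.tmul_mul_tmul, ← mul_assoc, one_mul,
      cmJ_ι_mul_s, cmJ_ι_mul_t, TensorProduct.add_tmul, TensorProduct.tmul_add]
    have h1 := tensorRel_mem (cmS ω) (cmT ω) c (cmJ ω (UniversalEnvelopingAlgebra.ι K X) * m) n
    have h2 := tensorRel_mem (cmS ω) (cmT ω) ((ω X : Module.End K A) c) m n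
    have h3 := tensorRel_mem (cmS ω) (cmT ω) c m (cmJ ω (UniversalEnvelopingAlgebra.ι K X) * n)
    convert add_mem (add_mem h1 h2) h3 using 1
    simp only [← mul_assoc]
    abel
  exact h hz

theorem cmDRep_rel (x : CM ω) {z : CM ω ⊗[K] CM ω}
    (hz : z ∈ tensorRel (cmS ω) (cmT ω)) : cmDRep ω x * z ∈ tensorRel (cmS ω) (cmT ω) := by
  have h : (tensorRel (cmS ω) (cmT ω)).mkQ ∘ₗ LinearMap.mulRight K z ∘ₗ cmDRep ω = 0 := by
    refine cm_ext' ω fun a u b => ?_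
    simp only [LinearMap.comp_apply, LinearMap.mulRight_apply, LinearMap.zero_apply,
      Submodule.mkQ_apply, Submodule.Quotient.mk_eq_zero]
    rw [cmElem_eq, cmDRep_bilin, cmDRep_J, mul_assoc]
    exact cm_rel_left ω a b (cmE_rel ω u hz)
  have := DFunLike.congr_fun h x
  simpa only [LinearMap.comp_apply, LinearMap.mulRight_apply, LinearMap.zero_apply,
    Submodule.mkQ_apply, Submodule.Quotient.mk_eq_zero] using this

theorem cmDRep_ι_mul (X : L) (y : CM ω) :
    cmDRep ω (cmJ ω (UniversalEnvelopingAlgebra.ι K X) * y) =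
      cmE ω (UniversalEnvelopingAlgebra.ι K X) * cmDRep ω y := by
  have h : cmDRep ω ∘ₗ LinearMap.mulLeft K (cmJ ω (UniversalEnvelopingAlgebra.ι K X)) =
      LinearMap.mulLeft K (cmE ω (UniversalEnvelopingAlgebra.ι K X)) ∘ₗ cmDRep ω := by
    refine cm_ext' ω fun a u b => ?_
    simp only [LinearMap.comp_apply, LinearMap.mulLeft_apply, cmJ_ι_mul, map_add, cmDRep_elem,
      cmE_ι, Bialgebra.comul_mul, uea_comul_ι]
    generalize Coalgebra.comul (R := K) u = v
    induction v using TensorProduct.induction_on with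
    | zero => simp
    | tmul p q =>
      simp only [TensorProduct.map_tmul, add_mul, map_add, Algebra.TensorProduct.tmul_mul_tmul,
        cmMid_apply, cmJ_ι_mul, one_mul, der_one, cmElem_zero_left, cmElem_zero_right,
        TensorProduct.add_tmul, TensorProduct.tmul_add, TensorProduct.zero_tmul,
        TensorProduct.tmul_zero]
      abel
    | add x y hx hy =>
      simp only [map_add, mul_add] at hx hy ⊢
      rw [← hx, ← hy]
      abel
  exact DFunLike.congr_fun h y

theorem cmDRep_J_mul (u : UniversalEnvelopingAlgebra K L) (y : CM ω) :
    cmDRep ω (cmJ ω u * y) - cmE ω u * cmDRep ω y ∈ tensorRel (cmS ω) (cmT ω) := by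
  let S : Subalgebra K (UniversalEnvelopingAlgebra K L) :=
    { carrier := {u | ∀ y, cmDRep ω (cmJ ω u * y) - cmE ω u * cmDRep ω y ∈
        tensorRel (cmS ω) (cmT ω)}
      mul_mem' := by
        intro u v hu hv y
        have h1 := hu (cmJ ω v * y)
        have h2 := cmE_rel ω u (hv y)
        convert add_mem h1 h2 using 1
        rw [map_mul (cmJ ω), map_mul (cmE ω), mul_sub, mul_assoc, mul_assoc]
        abel
      add_mem' := by
        intro u v hu hv y
        convert add_mem (hu y) (hv y) using 1
        rw [map_add, map_add, add_mul, add_mul, map_add]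
        abel
      algebraMap_mem' := by
        intro c y
        rw [AlgHom.commutes, AlgHom.commutes, ← Algebra.smul_def, ← Algebra.smul_def, map_smul,
          sub_self]
        exact zero_mem _ }
  refine uea_mem_subalgebra S (fun X y => ?_) u y
  rw [cmDRep_ι_mul, sub_self]
  exact zero_mem _

theorem cmDRep_mul (x y : CM ω) :
    cmDRep ω (x * y) - cmDRep ω x * cmDRep ω y ∈ tensorRel (cmS ω) (cmT ω) := by
  have h : (tensorRel (cmS ω) (cmT ω)).mkQ ∘ₗ (cmDRep ω ∘ₗ LinearMap.mulRight K y -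
      LinearMap.mulRight K (cmDRep ω y) ∘ₗ cmDRep ω) = 0 := by
    refine cm_ext' ω fun a u b => ?_
    simp only [LinearMap.comp_apply, LinearMap.mulRight_apply, LinearMap.zero_apply,
      LinearMap.sub_apply, Submodule.mkQ_apply, Submodule.Quotient.mk_eq_zero]
    rw [cmElem_eq, mul_assoc, cmDRep_bilin, cmDRep_bilin, cmDRep_J, mul_assoc, ← mul_sub]
    exact cm_rel_left ω a b (cmDRep_J_mul ω u y)
  have := DFunLike.congr_fun h x
  simpa only [LinearMap.comp_apply, LinearMap.mulRight_apply, LinearMap.zero_apply,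
    LinearMap.sub_apply, Submodule.mkQ_apply, Submodule.Quotient.mk_eq_zero] using this

theorem cmε_bimod (a b : A) (x : A ⊗[K] (UniversalEnvelopingAlgebra K L ⊗[K] A)) :
    cmε ω (toCM ω (cmBimod _ a b x)) = a * cmε ω (toCM ω x) * b := by
  have h : cmε ω ∘ₗ (toCM ω).toLinearMap ∘ₗ cmBimod _ a b =
      LinearMap.mulRight K b ∘ₗ LinearMap.mulLeft K a ∘ₗ cmε ω ∘ₗ (toCM ω).toLinearMap := by
    refine cm_ext fun c u d => ?_
    change cmε ω (cmElem ω (a * c) u (d * b)) = a * cmε ω (cmElem ω c u d) * b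
    simp [cmε_elem, mul_assoc]
  exact DFunLike.congr_fun h x

theorem cmε_act (u : UniversalEnvelopingAlgebra K L)
    (x : A ⊗[K] (UniversalEnvelopingAlgebra K L ⊗[K] A)) :
    cmε ω (toCM ω (cmAct ω u x)) = anchorAct ω u (cmε ω (toCM ω x)) := by
  let S : Subalgebra K (UniversalEnvelopingAlgebra K L) :=
    { carrier := {u | ∀ x, cmε ω (toCM ω (cmAct ω u x)) = anchorAct ω u (cmε ω (toCM ω x))}
      mul_mem' := by
        intro u v hu hv x
        rw [map_mul, map_mul, Module.End.mul_apply, Module.End.mul_apply, hu, hv]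
      add_mem' := by
        intro u v hu hv x
        rw [map_add, map_add, LinearMap.add_apply, LinearMap.add_apply, ← hu, ← hv, map_add,
          map_add]
      algebraMap_mem' := by
        intro c x
        rw [AlgHom.commutes, AlgHom.commutes, Module.algebraMap_end_apply,
          Module.algebraMap_end_apply, map_smul, map_smul] }
  refine uea_mem_subalgebra S (fun X x => ?_) u x
  have h : cmε ω ∘ₗ (toCM ω).toLinearMap ∘ₗ cmAct ω (UniversalEnvelopingAlgebra.ι K X) =
      anchorAct ω (UniversalEnvelopingAlgebra.ι K X) ∘ₗ cmε ω ∘ₗ (toCM ω).toLinearMap := by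
    have hE : ∀ a u b, toCM ω (a ⊗ₜ[K] (u ⊗ₜ[K] b)) = cmElem ω a u b := fun _ _ _ => rfl
    refine cm_ext fun c v d => ?_
    simp only [LinearMap.comp_apply, cmAct_ι, map_add, LinearEquiv.coe_coe]
    simp only [hE, cmε_elem, anchorAct_ι, Bialgebra.counit_mul, uea_counit_ι,
      der_apply, map_smul, zero_mul, zero_smul, mul_zero, add_zero]
  exact DFunLike.congr_fun h x

theorem cmε_mul_congr (x y y' : CM ω) (h : cmε ω y = cmε ω y') :
    cmε ω (x * y) = cmε ω (x * y') := by
  have h : cmε ω ∘ₗ LinearMap.mulRight K y = cmε ω ∘ₗ LinearMap.mulRight K y' := by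
    refine cm_ext' ω fun a u b => ?_
    simp only [LinearMap.comp_apply, LinearMap.mulRight_apply, cmElem_mul, cmε_bimod, cmε_act,
      LinearEquiv.apply_symm_apply, h]
  exact DFunLike.congr_fun h x

theorem cmε_s (a : A) : cmε ω (cmS ω a) = a := by
  rw [cmS_apply, cmε_elem]
  simp

theorem cmε_t (a : A) : cmε ω (cmT ω (op a)) = a := by
  rw [cmT_apply, cmε_elem]
  simp

theorem cmST_mul (a b : A) (x : CM ω) :
    cmS ω a * cmT ω (op b) * x = toCM ω (cmBimod _ a b ((toCM ω).symm x)) := by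
  rw [cmS_apply, cmT_apply, cmElem_one_mul, cmElem_mul, map_one, mul_one, mul_one,
    Module.End.one_apply]

theorem cmε_ST_mul (a b : A) (x : CM ω) :
    cmε ω (cmS ω a * cmT ω (op b) * x) = a * cmε ω x * b := by
  rw [cmST_mul, cmε_bimod, LinearEquiv.apply_symm_apply]

theorem cm_rep_sub {x : CM ω} {z : CM ω ⊗[K] CM ω}
    (h : (tensorRel (cmS ω) (cmT ω)).mkQ z = cmΔ ω x) :
    z - cmDRep ω x ∈ tensorRel (cmS ω) (cmT ω) := by
  rw [← Submodule.Quotient.mk_eq_zero, ← Submodule.mkQ_apply, map_sub, h]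
  exact sub_self _

theorem cm_mkQ_eq {z w : CM ω ⊗[K] CM ω} :
    (tensorRel (cmS ω) (cmT ω)).mkQ z = (tensorRel (cmS ω) (cmT ω)).mkQ w ↔
      z - w ∈ tensorRel (cmS ω) (cmT ω) := by
  rw [← Submodule.Quotient.mk_eq_zero, ← Submodule.mkQ_apply, map_sub, sub_eq_zero]

theorem cm_coassoc_rep (x : CM ω) :
    TensorProduct.assoc K (CM ω) (CM ω) (CM ω) ((cmDRep ω).rTensor _ (cmDRep ω x)) =
      (cmDRep ω).lTensor _ (cmDRep ω x) := by
  have h : (TensorProduct.assoc K (CM ω) (CM ω) (CM ω)).toLinearMap ∘ₗ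
      (cmDRep ω).rTensor _ ∘ₗ cmDRep ω = (cmDRep ω).lTensor _ ∘ₗ cmDRep ω := by
    refine cm_ext' ω fun a u b => ?_
    simp only [LinearMap.comp_apply, LinearEquiv.coe_coe, cmDRep_elem]
    have hl : ∀ v : UniversalEnvelopingAlgebra K L ⊗[K] UniversalEnvelopingAlgebra K L,
        TensorProduct.assoc K (CM ω) (CM ω) (CM ω) ((cmDRep ω).rTensor _
          (TensorProduct.map (cmMid ω a 1) (cmMid ω 1 b) v)) =
        TensorProduct.map (cmMid ω a 1) (TensorProduct.map (cmMid ω 1 1) (cmMid ω 1 b))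
          (TensorProduct.assoc K _ _ _ ((Coalgebra.comul (R := K)).rTensor _ v)) := by
      intro v
      induction v using TensorProduct.induction_on with
      | zero => simp
      | add x y hx hy => simp only [map_add, hx, hy]
      | tmul p q =>
        simp only [TensorProduct.map_tmul, LinearMap.rTensor_tmul, cmMid_apply, cmDRep_elem]
        generalize Coalgebra.comul (R := K) p = w
        induction w using TensorProduct.induction_on with
        | zero => simp
        | add x y hx hy => simp only [map_add, TensorProduct.add_tmul, hx, hy]
        | tmul p' q' => rfl
    have hr : ∀ v : UniversalEnvelopingAlgebra K L ⊗[K] UniversalEnvelopingAlgebra K L,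
        (cmDRep ω).lTensor _ (TensorProduct.map (cmMid ω a 1) (cmMid ω 1 b) v) =
        TensorProduct.map (cmMid ω a 1) (TensorProduct.map (cmMid ω 1 1) (cmMid ω 1 b))
          ((Coalgebra.comul (R := K)).lTensor _ v) := by
      intro v
      induction v using TensorProduct.induction_on with
      | zero => simp
      | add x y hx hy => simp only [map_add, hx, hy]
      | tmul p q =>
        simp only [TensorProduct.map_tmul, LinearMap.lTensor_tmul, cmMid_apply, cmDRep_elem]
    rw [hl, hr, Coalgebra.coassoc_apply]
  exact DFunLike.congr_fun h x

theorem cm_assocLeft (y : (CM ω ⊗[K] CM ω) ⊗[K] CM ω) :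
    tensorAssocLeft (cmS ω) (cmT ω) ((tensorRel (cmS ω) (cmT ω)).mkQ.rTensor _ y) =
      (tensorRel₃ (cmS ω) (cmT ω)).mkQ (TensorProduct.assoc K _ _ _ y) := by
  induction y using TensorProduct.induction_on with
  | zero => simp
  | add x y hx hy => simp only [map_add, hx, hy]
  | tmul p q => rfl

theorem cm_assocRight (y : CM ω ⊗[K] (CM ω ⊗[K] CM ω)) :
    tensorAssocRight (cmS ω) (cmT ω) ((tensorRel (cmS ω) (cmT ω)).mkQ.lTensor _ y) =
      (tensorRel₃ (cmS ω) (cmT ω)).mkQ y := by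
  induction y using TensorProduct.induction_on with
  | zero => simp
  | add x y hx hy => simp only [map_add, hx, hy]
  | tmul p q => rfl

theorem cm_coassoc (x : CM ω) (z : CM ω ⊗[K] CM ω)
    (hz : (tensorRel (cmS ω) (cmT ω)).mkQ z = cmΔ ω x) :
    tensorAssocLeft (cmS ω) (cmT ω) ((cmΔ ω).rTensor _ z) =
      tensorAssocRight (cmS ω) (cmT ω) ((cmΔ ω).lTensor _ z) := by
  have hL : ∀ z, tensorAssocLeft (cmS ω) (cmT ω) ((cmΔ ω).rTensor _ z) =
      (tensorRel₃ (cmS ω) (cmT ω)).mkQ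
        (TensorProduct.assoc K _ _ _ ((cmDRep ω).rTensor _ z)) := fun z => by
    rw [← cm_assocLeft, cmΔ, LinearMap.rTensor_comp, LinearMap.comp_apply]
  have hR : ∀ z, tensorAssocRight (cmS ω) (cmT ω) ((cmΔ ω).lTensor _ z) =
      (tensorRel₃ (cmS ω) (cmT ω)).mkQ ((cmDRep ω).lTensor _ z) := fun z => by
    rw [← cm_assocRight, cmΔ, LinearMap.lTensor_comp, LinearMap.comp_apply]
  have h1 : tensorRel (cmS ω) (cmT ω) ≤ LinearMap.ker ((tensorRel₃ (cmS ω) (cmT ω)).mkQ ∘ₗ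
      (TensorProduct.assoc K (CM ω) (CM ω) (CM ω)).toLinearMap ∘ₗ (cmDRep ω).rTensor _) := by
    refine Submodule.span_le.2 ?_
    rintro _ ⟨a, m, n, rfl⟩
    refine LinearMap.mem_ker.2 ?_
    have h := cmDRep_bilin ω 1 a m
    rw [map_one, one_mul] at h
    simp only [LinearMap.comp_apply, LinearEquiv.coe_coe, LinearMap.rTensor_tmul, h, map_sub]
    rw [← map_sub, ← map_sub, Submodule.mkQ_apply, Submodule.Quotient.mk_eq_zero]
    generalize cmDRep ω m = w
    induction w using TensorProduct.induction_on with
    | zero => simp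
    | add x y hx hy =>
      convert add_mem hx hy using 1
      simp only [mul_add, TensorProduct.add_tmul, map_sub, map_add]
      abel
    | tmul p q =>
      refine Submodule.subset_span (Or.inr ⟨a, p, q, n, ?_⟩)
      simp
  have h2 : tensorRel (cmS ω) (cmT ω) ≤ LinearMap.ker ((tensorRel₃ (cmS ω) (cmT ω)).mkQ ∘ₗ
      (cmDRep ω).lTensor (CM ω)) := by
    refine Submodule.span_le.2 ?_
    rintro _ ⟨a, m, n, rfl⟩
    refine LinearMap.mem_ker.2 ?_
    have h := cmDRep_bilin ω a 1 n
    rw [MulOpposite.op_one, map_one, mul_one] at h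
    simp only [LinearMap.comp_apply, LinearMap.lTensor_tmul, h, map_sub]
    rw [← map_sub, Submodule.mkQ_apply, Submodule.Quotient.mk_eq_zero]
    generalize cmDRep ω n = w
    induction w using TensorProduct.induction_on with
    | zero => simp
    | add x y hx hy =>
      convert add_mem hx hy using 1
      simp only [mul_add, TensorProduct.tmul_add]
      abel
    | tmul p q =>
      refine Submodule.subset_span (Or.inl ⟨a, m, p, q, ?_⟩)
      simp
  have hz' := cm_rep_sub ω hz
  have e1 := LinearMap.mem_ker.1 (h1 hz')
  have e2 := LinearMap.mem_ker.1 (h2 hz')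
  rw [map_sub, sub_eq_zero] at e1 e2
  simp only [LinearMap.comp_apply, LinearEquiv.coe_coe] at e1 e2
  rw [hL, hR, e1, e2, cm_coassoc_rep]

theorem cm_counit_left (x : CM ω) (z : CM ω ⊗[K] CM ω)
    (hz : (tensorRel (cmS ω) (cmT ω)).mkQ z = cmΔ ω x) :
    LinearMap.mul' K (CM ω) (((cmS ω).toLinearMap ∘ₗ cmε ω).rTensor _ z) = x := by
  have h1 : tensorRel (cmS ω) (cmT ω) ≤ LinearMap.ker (LinearMap.mul' K (CM ω) ∘ₗ
      ((cmS ω).toLinearMap ∘ₗ cmε ω).rTensor (CM ω)) := by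
    refine Submodule.span_le.2 ?_
    rintro _ ⟨a, m, n, rfl⟩
    have h' := cmε_ST_mul ω 1 a m
    rw [map_one, one_mul, one_mul] at h'
    simp [h', mul_assoc]
  have h2 : (LinearMap.mul' K (CM ω) ∘ₗ ((cmS ω).toLinearMap ∘ₗ cmε ω).rTensor (CM ω)) ∘ₗ
      cmDRep ω = LinearMap.id := by
    refine cm_ext' ω fun a u b => ?_
    have h3 : ∀ v : UniversalEnvelopingAlgebra K L ⊗[K] UniversalEnvelopingAlgebra K L,
        (LinearMap.mul' K (CM ω) ∘ₗ ((cmS ω).toLinearMap ∘ₗ cmε ω).rTensor (CM ω))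
          (TensorProduct.map (cmMid ω a 1) (cmMid ω 1 b) v) =
        cmMid ω a b (TensorProduct.lid K _ ((Coalgebra.counit (R := K)).rTensor _ v)) := by
      intro v
      induction v using TensorProduct.induction_on with
      | zero => simp
      | add x y hx hy => simp only [map_add, hx, hy]
      | tmul p q =>
        simp only [LinearMap.comp_apply, TensorProduct.map_tmul, LinearMap.rTensor_tmul,
          LinearMap.mul'_apply, cmMid_apply, cmε_elem, AlgHom.toLinearMap_apply,
          TensorProduct.lid_tmul, map_smul, mul_smul_comm, mul_one, smul_mul_assoc]
        rw [cmS_apply, cmElem_one_mul, mul_one, mul_one]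
    rw [LinearMap.comp_apply, cmDRep_elem, h3, Coalgebra.rTensor_counit_comul]
    simp [cmMid_apply]
  have e1 := LinearMap.mem_ker.1 (h1 (cm_rep_sub ω hz))
  rw [map_sub, sub_eq_zero] at e1
  exact e1.trans (DFunLike.congr_fun h2 x)

theorem cm_counit_right (x : CM ω) (z : CM ω ⊗[K] CM ω)
    (hz : (tensorRel (cmS ω) (cmT ω)).mkQ z = cmΔ ω x) :
    LinearMap.mul' K (CM ω) (TensorProduct.comm K (CM ω) (CM ω)
      (((cmT ω).toLinearMap ∘ₗ (MulOpposite.opLinearEquiv K).toLinearMap ∘ₗ cmε ω).lTensor _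
        z)) = x := by
  let f : CM ω ⊗[K] CM ω →ₗ[K] CM ω := LinearMap.mul' K (CM ω) ∘ₗ
    (TensorProduct.comm K (CM ω) (CM ω)).toLinearMap ∘ₗ
      ((cmT ω).toLinearMap ∘ₗ (MulOpposite.opLinearEquiv K).toLinearMap ∘ₗ cmε ω).lTensor (CM ω)
  have h1 : tensorRel (cmS ω) (cmT ω) ≤ LinearMap.ker f := by
    refine Submodule.span_le.2 ?_
    rintro _ ⟨a, m, n, rfl⟩
    have h' := cmε_ST_mul ω a 1 n
    rw [MulOpposite.op_one, map_one, mul_one, mul_one] at h'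
    simp [f, h', mul_assoc]
  have h2 : f ∘ₗ cmDRep ω = LinearMap.id := by
    refine cm_ext' ω fun a u b => ?_
    have h3 : ∀ v : UniversalEnvelopingAlgebra K L ⊗[K] UniversalEnvelopingAlgebra K L,
        f (TensorProduct.map (cmMid ω a 1) (cmMid ω 1 b) v) =
        cmMid ω a b (TensorProduct.rid K _ ((Coalgebra.counit (R := K)).lTensor _ v)) := by
      intro v
      induction v using TensorProduct.induction_on with
      | zero => simp
      | add x y hx hy => simp only [map_add, hx, hy]
      | tmul p q =>
        simp only [f, LinearMap.comp_apply, TensorProduct.map_tmul, LinearMap.lTensor_tmul,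
          LinearMap.mul'_apply, cmMid_apply, cmε_elem, AlgHom.toLinearMap_apply,
          LinearEquiv.coe_coe, TensorProduct.comm_tmul, MulOpposite.coe_opLinearEquiv,
          one_mul, TensorProduct.rid_tmul, map_smul, smul_mul_assoc]
        rw [cmT_apply, cmElem_one_mul, one_mul, one_mul]
    rw [LinearMap.comp_apply, cmDRep_elem, h3, Coalgebra.lTensor_counit_comul]
    simp [cmMid_apply]
  have e1 := LinearMap.mem_ker.1 (h1 (cm_rep_sub ω hz))
  rw [map_sub, sub_eq_zero] at e1
  exact e1.trans (DFunLike.congr_fun h2 x)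

/-- The Connes-Moscovici bialgebroid `A ⊙ U(L) ⊙ A` of the anchored Lie algebra `(L, ω)`. -/
def cmBialgebroid : LeftBialgebroid K A (CM ω) where
  s := cmS ω
  t := cmT ω
  commute := cm_commute ω
  Δ := cmΔ ω
  ε := cmε ω
  Δ_bilin a b x z hz := by
    refine Eq.symm ((cm_mkQ_eq ω).2 ?_)
    rw [cmDRep_bilin, ← mul_sub]
    exact cm_rel_left ω a b (cm_rep_sub ω hz)
  ε_bilin := cmε_ST_mul ω
  coassoc := cm_coassoc ω
  counit_left := cm_counit_left ω
  counit_right := cm_counit_right ω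
  takeuchi x z hz a := by
    rw [cm_mkQ_eq, ← mul_sub]
    have h := tensorRel_mem (cmS ω) (cmT ω) a 1 1
    rw [mul_one, mul_one] at h
    convert add_mem (tensorRel_mul_right _ _ (cm_rep_sub ω hz)
      (cmT ω (op a) ⊗ₜ[K] 1 - 1 ⊗ₜ[K] cmS ω a)) (cmDRep_rel ω x h) using 1
    rw [sub_mul]
    abel
  Δ_one := by
    have h : cmDRep ω (cmJ ω 1) = 1 ⊗ₜ[K] 1 := by
      rw [cmDRep_J, map_one, Algebra.TensorProduct.one_def]
    rw [map_one] at h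
    exact congrArg _ h
  Δ_mul x y z w hz hw := by
    refine Eq.symm ((cm_mkQ_eq ω).2 ?_)
    convert sub_mem (add_mem (tensorRel_mul_right _ _ (cm_rep_sub ω hz) w)
      (cmDRep_rel ω x (cm_rep_sub ω hw))) (cmDRep_mul ω x y) using 1
    rw [sub_mul, mul_sub]
    abel
  ε_mul_s x y := cmε_mul_congr ω x _ _ (cmε_s ω _)
  ε_mul_t x y := cmε_mul_congr ω x _ _ (cmε_t ω _)
  ε_one := cmε_s ω 1

/-! ### The ingredients of the semi-direct product `L ⋉_δ ⟨s - t⟩` -/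

theorem cmJ_mem_prim (X : L) :
    cmElem ω 1 (UniversalEnvelopingAlgebra.ι K X) 1 ∈ (cmBialgebroid ω).prim := by
  have h := (cmDRep_J ω (UniversalEnvelopingAlgebra.ι K X)).trans (cmE_ι ω X)
  exact congrArg (tensorRel (cmS ω) (cmT ω)).mkQ h

/-- The Lie algebra map `γ : L → Prim(A ⊙ U(L) ⊙ A)`, `X ↦ 1 ⊗ X ⊗ 1`. -/
def cmγ : L →ₗ⁅K⁆ (cmBialgebroid ω).prim where
  toFun X := ⟨cmElem ω 1 (UniversalEnvelopingAlgebra.ι K X) 1, cmJ_mem_prim ω X⟩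
  map_add' X Y := Subtype.ext (by
    change cmJ ω _ = cmJ ω _ + cmJ ω _
    rw [map_add, map_add])
  map_smul' c X := Subtype.ext (by
    change cmJ ω _ = c • cmJ ω _
    rw [map_smul, map_smul])
  map_lie' {X Y} := Subtype.ext (by
    change cmJ ω _ = cmJ ω _ * cmJ ω _ - cmJ ω _ * cmJ ω _
    rw [LieHom.map_lie, LieRing.of_associative_ring_bracket, map_sub, map_mul, map_mul])

theorem cmγ_anchor (X : L) : (cmBialgebroid ω).primAnchor (cmγ ω X) = ω X := by
  ext a
  change cmε ω (cmJ ω (UniversalEnvelopingAlgebra.ι K X) * cmT ω (op a)) = _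
  rw [cmJ_ι_mul_t, map_add, cmε_t, cmT_apply, cmJ_apply, cmElem_one_mul, cmε_elem, uea_counit_ι]
  simp

/-- The map `δ : L → Der_K(⟨s - t⟩)`, `X ↦ [1 ⊗ X ⊗ 1, -]`. -/
def cmδ : L →ₗ⁅K⁆ LieDerivation K (cmBialgebroid ω).stIdeal (cmBialgebroid ω).stIdeal :=
  (idealAd (cmBialgebroid ω).stIdeal).comp (cmγ ω)

theorem cmδ_compat (X : L) (y : (cmBialgebroid ω).stIdeal) :
    ⁅ω X, (cmBialgebroid ω).stAnchor y⁆ = (cmBialgebroid ω).stAnchor (cmδ ω X y) := by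
  change _ = (cmBialgebroid ω).primAnchor ⁅cmγ ω X, (y : (cmBialgebroid ω).prim)⁆
  rw [LieHom.map_lie, cmγ_anchor]
  rfl

/-- The anchor of the semi-direct product `L ⋉_δ ⟨s - t⟩`. -/
def cmSemidirectAnchor :
    LieAlgebra.SemiDirectSum (cmBialgebroid ω).stIdeal L (cmδ ω) →ₗ⁅K⁆ DerK K A :=
  semidirectAnchor (cmδ ω) ω (cmBialgebroid ω).stAnchor (cmδ_compat ω)

end ConnesMoscovici

/-! ### The Poincaré-Birkhoff-Witt representation -/

section PBW

/-! Write B for `A ⊙ U(L) ⊙ A`. Since A is nonzero, there is a K-linear functional f on A with f(1)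
= 1. Everything needed about B ⊗_A B is read off through maps on B ⊗_K B that are built from f and
kill the balancing relations, so B ⊗_A B never has to be described explicitly.

Surjectivity. Let x = ∑ a ⊗ u ⊗ b be primitive, and put p = ∑ f(a)ε(u)b, q = ∑ f(b)ε(u)a and w = ∑
f(a)f(b)u. Contracting the left leg of Δ(x) with f and ε gives ∑ f(a) ⊗ u ⊗ b = s(p) + x;
contracting the right leg gives ∑ a ⊗ u ⊗ f(b) = x + t(q). Together they yield 1 ⊗ w ⊗ 1 = s(p) + x
+ t(q), and the counit gives ε(w)1 = p + q. Eliminating p, x = 1 ⊗ (w - ε(w)) ⊗ 1 + s(q) - t(q)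
(`exists_eq_of_mem_prim`). The first summand is again primitive, so w - ε(w) is primitive in U(L)
(`comul_of_cmJ_mem_prim`), hence lies in L (`exists_ι_eq_of_primitive`).

The last fact rests on Ψ(u) = ∑ u₁u₂. On the filtration by powers of K + L, Ψ acts on the n-th power
as 2^n modulo the previous one (`ueaPsi_sub_mem`), while Ψ(u) = 2u for u primitive. In
characteristic zero 2^n ≠ 2 for n ≥ 2, so u descends to K + L, and the counit removes the constant.

Injectivity. Applying f at both ends kills s(a) - t(a) and leaves X in U(L), so X = 0 once L embeds
into U(L) (`uea_ι_injective`). This weak form of Poincaré-Birkhoff-Witt comes from a representation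
of L on polynomials (`pbwRep`) in which x is recovered from its action on 1.

Brackets and anchors match because δ(X) is the bracket with 1 ⊗ X ⊗ 1, whose anchor is ω(X)
(`cmγ_anchor`). -/

theorem eq_zero_or_cons_min {I : Type*} [LinearOrder I] (M : Multiset I) :
    M = 0 ∨ ∃ (j : I) (N : Multiset I), (∀ k ∈ N, j ≤ k) ∧ M = j ::ₘ N := by
  rcases h : M.sort with _ | ⟨j, l⟩
  · left
    rw [← Multiset.sort_eq M (· ≤ ·), h, Multiset.coe_nil]
  · right
    refine ⟨j, l, fun k hk => ?_, by rw [← Multiset.sort_eq M (· ≤ ·), h, Multiset.cons_coe]⟩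
    have := M.pairwise_sort (· ≤ ·)
    rw [h] at this
    exact (List.pairwise_cons.1 this).1 k hk

variable {K L I : Type*} [Field K] [LieRing L] [LieAlgebra K L]

/-- The monomial attached to a multiset of basis indices. -/
noncomputable def pbwMonomial (K : Type*) {I : Type*} [Field K] (M : Multiset I) :
    Multiset I →₀ K := Finsupp.single M 1

/-- Polynomials of degree at most `n`. -/
noncomputable def pbwDeg (K I : Type*) [Field K] (n : ℕ) : Submodule K (Multiset I →₀ K) :=
  Submodule.span K (pbwMonomial K '' {M | M.card ≤ n})

theorem pbwMonomial_mem_deg {M : Multiset I} {n : ℕ} (h : M.card ≤ n) :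
    pbwMonomial K M ∈ pbwDeg K I n := Submodule.subset_span ⟨M, h, rfl⟩

theorem pbwDeg_mono {m n : ℕ} (h : m ≤ n) : pbwDeg K I m ≤ pbwDeg K I n :=
  Submodule.span_mono (Set.image_mono fun _ hM => le_trans hM h)

/-! ### The action of L on polynomials, defined by recursion on degree -/

variable [LinearOrder I] (b : Module.Basis I K L)

/-- The value of `x_i` on the monomial `M`, where `f` is the action on monomials of lower degree. -/
noncomputable def pbwStep (f : L →ₗ[K] (Multiset I →₀ K) →ₗ[K] (Multiset I →₀ K)) (i : I)
    (M : Multiset I) : Multiset I →₀ K :=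
  match M.sort with
  | [] => pbwMonomial K (i ::ₘ M)
  | j :: l => if i ≤ j then pbwMonomial K (i ::ₘ M) else
      pbwMonomial K (i ::ₘ M) +
        f (b j) (f (b i) (pbwMonomial K (l : Multiset I)) - pbwMonomial K (i ::ₘ (l : Multiset I))) +
        f ⁅b i, b j⁆ (pbwMonomial K (l : Multiset I))

/-- The action of `L` on polynomials, correct up to degree `n`. -/
noncomputable def pbwAux : ℕ → L →ₗ[K] (Multiset I →₀ K) →ₗ[K] (Multiset I →₀ K)
  | 0 => b.constr K fun i => Finsupp.linearCombination K fun M => pbwMonomial K (i ::ₘ M)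
  | n + 1 => b.constr K fun i => Finsupp.linearCombination K fun M =>
      if M.card ≤ n then pbwAux n (b i) (pbwMonomial K M) else pbwStep b (pbwAux n) i M

/-- The action of `L` on polynomials in a basis of `L`. -/
noncomputable def pbwAct : L →ₗ[K] (Multiset I →₀ K) →ₗ[K] (Multiset I →₀ K) :=
  b.constr K fun i => Finsupp.linearCombination K fun M =>
    pbwAux b M.card (b i) (pbwMonomial K M)

theorem pbwAct_basis (i : I) (M : Multiset I) :
    pbwAct b (b i) (pbwMonomial K M) = pbwAux b M.card (b i) (pbwMonomial K M) := by
  simp [pbwAct, pbwMonomial]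

theorem pbwAux_zero (i : I) (M : Multiset I) :
    pbwAux b 0 (b i) (pbwMonomial K M) = pbwMonomial K (i ::ₘ M) := by
  simp [pbwAux, pbwMonomial]

theorem pbwAux_succ (n : ℕ) (i : I) (M : Multiset I) :
    pbwAux b (n + 1) (b i) (pbwMonomial K M) =
      if M.card ≤ n then pbwAux b n (b i) (pbwMonomial K M) else pbwStep b (pbwAux b n) i M := by
  simp [pbwAux, pbwMonomial]

/-- Stage n + 1 copies stage n on monomials of degree at most n, so the value on a monomial is
constant from the stage equal to its degree onwards. -/
theorem pbwAux_monomial (n : ℕ) (x : L) (M : Multiset I) (h : M.card ≤ n) :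
    pbwAux b n x (pbwMonomial K M) = pbwAct b x (pbwMonomial K M) := by
  suffices H : (pbwAux b n).flip (pbwMonomial K M) = (pbwAct b).flip (pbwMonomial K M) from
    DFunLike.congr_fun H x
  refine b.ext fun i => ?_
  simp only [LinearMap.flip_apply]
  induction n with
  | zero => rw [pbwAct_basis, Nat.le_zero.1 h]
  | succ n ih =>
    by_cases h' : M.card ≤ n
    · rw [pbwAux_succ, if_pos h', ih h']
    · rw [pbwAct_basis, le_antisymm h (by omega)]

theorem pbwAux_eq (n : ℕ) (x : L) {w : Multiset I →₀ K} (hw : w ∈ pbwDeg K I n) :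
    pbwAux b n x w = pbwAct b x w := by
  induction hw using Submodule.span_induction with
  | mem w hw => obtain ⟨M, hM, rfl⟩ := hw; exact pbwAux_monomial b n x M hM
  | zero => simp
  | add u v _ _ hu hv => rw [map_add, map_add, hu, hv]
  | smul c u _ hu => rw [map_smul, map_smul, hu]

theorem pbwAct_mem_of {n : ℕ} (h : ∀ (i : I) (M : Multiset I), M.card ≤ n →
      pbwAct b (b i) (pbwMonomial K M) ∈ pbwDeg K I (n + 1)) (x : L) {w : Multiset I →₀ K}
    (hw : w ∈ pbwDeg K I n) : pbwAct b x w ∈ pbwDeg K I (n + 1) := by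
  induction hw using Submodule.span_induction with
  | mem w hw =>
    obtain ⟨M, hM, rfl⟩ := hw
    rw [← LinearMap.flip_apply]
    have : (⊤ : Submodule K L) ≤ (pbwDeg K I (n + 1)).comap
        ((pbwAct b).flip (pbwMonomial K M)) := by
      rw [← b.span_eq, Submodule.span_le]
      rintro _ ⟨i, rfl⟩
      exact h i M hM
    exact this trivial
  | zero => simp
  | add u v _ _ hu hv => rw [map_add]; exact add_mem hu hv
  | smul c u _ hu => rw [map_smul]; exact Submodule.smul_mem _ _ hu

/-- A lower bound put in front of a sorted list stays at its head; this replaces the sorted list in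
the recursion by a choice of least index. -/
theorem pbwStep_cons (f : L →ₗ[K] (Multiset I →₀ K) →ₗ[K] (Multiset I →₀ K)) (i j : I)
    (N : Multiset I) (hj : ∀ k ∈ N, j ≤ k) :
    pbwStep b f i (j ::ₘ N) = if i ≤ j then pbwMonomial K (i ::ₘ j ::ₘ N) else
      pbwMonomial K (i ::ₘ j ::ₘ N) +
        f (b j) (f (b i) (pbwMonomial K N) - pbwMonomial K (i ::ₘ N)) +
        f ⁅b i, b j⁆ (pbwMonomial K N) := by
  rw [pbwStep, Multiset.sort_cons _ _ _ hj]
  simp only [Multiset.sort_eq]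

theorem pbwAct_of_le (i : I) (M : Multiset I) (hi : ∀ k ∈ M, i ≤ k) :
    pbwAct b (b i) (pbwMonomial K M) = pbwMonomial K (i ::ₘ M) := by
  rw [pbwAct_basis]
  rcases eq_zero_or_cons_min M with rfl | ⟨j, N, hj, rfl⟩
  · rw [Multiset.card_zero, pbwAux_zero]
  -- The degree is one more than that of `N`, so the stage `N.card + 1` used here is exactly the one
  -- that takes the `pbwStep` branch.
  · rw [Multiset.card_cons, pbwAux_succ, if_neg (by simp), pbwStep_cons b _ i j N hj,
      if_pos (hi j (Multiset.mem_cons_self j N))]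

/-- The recursion unfolded with its stages replaced by the final action. The hypothesis `h` permits
this: it puts the argument of `b j` in degree at most `N.card`, where the stage is already final. It
is kept as a hypothesis because the proof of `pbwAct_sub_mem`, which supplies it, uses this lemma.
-/
theorem pbwAct_of_lt_aux (i j : I) (N : Multiset I) (hj : ∀ k ∈ N, j ≤ k) (hij : j < i)
    (h : pbwAct b (b i) (pbwMonomial K N) - pbwMonomial K (i ::ₘ N) ∈ pbwDeg K I N.card) :
    pbwAct b (b i) (pbwMonomial K (j ::ₘ N)) = pbwMonomial K (i ::ₘ j ::ₘ N) +
      pbwAct b (b j) (pbwAct b (b i) (pbwMonomial K N) - pbwMonomial K (i ::ₘ N)) +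
      pbwAct b ⁅b i, b j⁆ (pbwMonomial K N) := by
  rw [pbwAct_basis b i (j ::ₘ N), Multiset.card_cons, pbwAux_succ, if_neg (by simp),
    pbwStep_cons b _ i j N hj, if_neg hij.not_ge, pbwAux_monomial b _ _ _ le_rfl,
    pbwAux_monomial b _ _ _ le_rfl, pbwAux_eq b _ _ h]

/-- Each basis vector acts as multiplication by its variable up to terms that do not raise the
degree. When the least index j of the monomial is below i, the corrections are `b j` and `⁅b i, b
j⁆` applied to polynomials of degree at most `N.card`, and by induction the action raises that
degree by at most one. -/
theorem pbwAct_sub_mem (i : I) (M : Multiset I) :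
    pbwAct b (b i) (pbwMonomial K M) - pbwMonomial K (i ::ₘ M) ∈ pbwDeg K I M.card := by
  induction hn : M.card using Nat.strong_induction_on generalizing i M with
  | _ n ih =>
    subst hn
    rcases eq_zero_or_cons_min M with rfl | ⟨j, N, hj, rfl⟩
    · rw [pbwAct_of_le b i 0 (by simp), sub_self]
      exact zero_mem _
    · rcases le_or_gt i j with hij | hij
      · rw [pbwAct_of_le, sub_self]
        · exact zero_mem _
        · intro k hk
          rcases Multiset.mem_cons.1 hk with rfl | hk
          exacts [hij, hij.trans (hj k hk)]
      · rw [Multiset.card_cons] at ih ⊢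
        have h1 := ih N.card (Nat.lt_succ_self _) i N rfl
        have h2 : ∀ (x : L) {w : Multiset I →₀ K}, w ∈ pbwDeg K I N.card →
            pbwAct b x w ∈ pbwDeg K I (N.card + 1) := pbwAct_mem_of b fun k P hP => by
          have := ih P.card (Nat.lt_succ_of_le hP) k P rfl
          rw [← sub_add_cancel (pbwAct b (b k) (pbwMonomial K P)) (pbwMonomial K (k ::ₘ P))]
          exact add_mem (pbwDeg_mono (hP.trans (Nat.le_succ _)) this)
            (pbwMonomial_mem_deg (by simpa using hP))
        rw [pbwAct_of_lt_aux b i j N hj hij h1, add_assoc, add_sub_cancel_left]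
        exact add_mem (h2 _ h1) (h2 _ (pbwMonomial_mem_deg le_rfl))

/-! ### The bracket relation for the action -/

theorem pbwAct_of_lt (i j : I) (N : Multiset I) (hj : ∀ k ∈ N, j ≤ k) (hij : j < i) :
    pbwAct b (b i) (pbwAct b (b j) (pbwMonomial K N)) =
      pbwAct b (b j) (pbwAct b (b i) (pbwMonomial K N)) +
      pbwAct b ⁅b i, b j⁆ (pbwMonomial K N) := by
  rw [pbwAct_of_le b j N hj, pbwAct_of_lt_aux b i j N hj hij (pbwAct_sub_mem b i N), map_sub,
    pbwAct_of_le b j (i ::ₘ N), Multiset.cons_swap]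
  · abel
  · intro k hk
    rcases Multiset.mem_cons.1 hk with rfl | hk
    exacts [hij.le, hj k hk]

/-- For j < i the recursion was designed to give this relation. If i < j, then i also bounds `N`
from below, and antisymmetry of the bracket exchanges the two indices. -/
theorem pbwAct_lie_of_le (i j : I) (N : Multiset I) (hj : ∀ k ∈ N, j ≤ k) :
    pbwAct b (b i) (pbwAct b (b j) (pbwMonomial K N)) =
      pbwAct b (b j) (pbwAct b (b i) (pbwMonomial K N)) +
      pbwAct b ⁅b i, b j⁆ (pbwMonomial K N) := by
  rcases lt_trichotomy i j with h | rfl | h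
  · rw [pbwAct_of_lt b j i N (fun k hk => h.le.trans (hj k hk)) h, ← lie_skew (b i) (b j), map_neg,
      LinearMap.neg_apply]
    abel
  · simp
  · exact pbwAct_of_lt b i j N hj h

theorem pbwAct_lie_of_monomial {n : ℕ}
    (h : ∀ (i j : I) (M : Multiset I), M.card ≤ n →
      pbwAct b (b i) (pbwAct b (b j) (pbwMonomial K M)) =
        pbwAct b (b j) (pbwAct b (b i) (pbwMonomial K M)) +
        pbwAct b ⁅b i, b j⁆ (pbwMonomial K M)) (x y : L) {w : Multiset I →₀ K}
    (hw : w ∈ pbwDeg K I n) :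
    pbwAct b x (pbwAct b y w) = pbwAct b y (pbwAct b x w) + pbwAct b ⁅x, y⁆ w := by
  induction hw using Submodule.span_induction with
  | mem w hw =>
    obtain ⟨M, hM, rfl⟩ := hw
    induction b.mem_span x using Submodule.span_induction with
    | zero => simp
    | add u v _ _ hu hv => simp only [map_add, LinearMap.add_apply, add_lie, hu, hv]; abel
    | smul c u _ hu => simp only [map_smul, LinearMap.smul_apply, smul_lie, hu, smul_add]
    | mem x hx =>
      obtain ⟨i, rfl⟩ := hx
      induction b.mem_span y using Submodule.span_induction with
      | zero => simp
      | add u v _ _ hu hv => simp only [map_add, LinearMap.add_apply, lie_add, hu, hv]; abel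
      | smul c u _ hu => simp only [map_smul, LinearMap.smul_apply, lie_smul, hu, smul_add]
      | mem y hy =>
        obtain ⟨j, rfl⟩ := hy
        exact h i j M hM
  | zero => simp
  | add u v _ _ hu hv => simp only [map_add, hu, hv]; abel
  | smul c u _ hu => simp only [map_smul, hu, smul_add]

/-- Let k be the least index of `M`. Only the case k < i, k < j is not covered by
`pbwAct_lie_of_le`. There the monomial is `b k` acting on the smaller monomial `P`; moving `b k` to
the left in both products leaves double brackets that match by the Jacobi identity. -/
theorem pbwAct_lie_monomial (i j : I) (M : Multiset I) :
    pbwAct b (b i) (pbwAct b (b j) (pbwMonomial K M)) =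
      pbwAct b (b j) (pbwAct b (b i) (pbwMonomial K M)) +
      pbwAct b ⁅b i, b j⁆ (pbwMonomial K M) := by
  induction hn : M.card using Nat.strong_induction_on generalizing i j M with
  | _ n ih =>
    subst hn
    rcases eq_zero_or_cons_min M with rfl | ⟨k, P, hk, rfl⟩
    · exact pbwAct_lie_of_le b i j 0 (by simp)
    rw [Multiset.card_cons] at ih
    have IH : ∀ (x y : L) {w : Multiset I →₀ K}, w ∈ pbwDeg K I P.card →
        pbwAct b x (pbwAct b y w) = pbwAct b y (pbwAct b x w) + pbwAct b ⁅x, y⁆ w :=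
      pbwAct_lie_of_monomial b fun i j M hM => ih M.card (Nat.lt_succ_of_le hM) i j M rfl
    have hP : pbwMonomial K P ∈ pbwDeg K I P.card := pbwMonomial_mem_deg le_rfl
    have le_cons : ∀ {i : I}, i ≤ k → ∀ l ∈ k ::ₘ P, i ≤ l := fun {i} hi l hl => by
      rcases Multiset.mem_cons.1 hl with rfl | hl
      exacts [hi, hi.trans (hk l hl)]
    rcases le_or_gt j k with hjk | hjk
    · exact pbwAct_lie_of_le b i j _ (le_cons hjk)
    rcases le_or_gt i k with hik | hik
    · rw [pbwAct_lie_of_le b j i _ (le_cons hik), ← lie_skew (b i) (b j), map_neg,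
        LinearMap.neg_apply]
      abel
    have key : ∀ {i j : I}, k < i → k < j →
        pbwAct b (b i) (pbwAct b (b k) (pbwAct b (b j) (pbwMonomial K P))) =
          pbwAct b (b k) (pbwAct b (b i) (pbwAct b (b j) (pbwMonomial K P))) +
          pbwAct b ⁅b i, b k⁆ (pbwAct b (b j) (pbwMonomial K P)) := by
      intro i j hik hjk
      -- The degree induction covers the remainder `w`, whereas the leading monomial `j ::ₘ P` is
      -- too large for it but is bounded below by k, so the direct case applies.
      obtain ⟨w, hw, hw'⟩ : ∃ w ∈ pbwDeg K I P.card,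
          pbwAct b (b j) (pbwMonomial K P) = w + pbwMonomial K (j ::ₘ P) :=
        ⟨_, pbwAct_sub_mem b j P, (sub_add_cancel _ _).symm⟩
      simp only [hw', map_add]
      rw [IH (b i) (b k) hw, pbwAct_lie_of_le b i k (j ::ₘ P)]
      · abel
      · intro l hl
        rcases Multiset.mem_cons.1 hl with rfl | hl
        exacts [hjk.le, hk l hl]
    have J : ⁅b i, ⁅b j, b k⁆⁆ - ⁅b j, ⁅b i, b k⁆⁆ = ⁅⁅b i, b j⁆, b k⁆ := (lie_lie _ _ _).symm
    rw [← pbwAct_of_le b k P hk, IH (b j) (b k) hP, IH (b i) (b k) hP, map_add, map_add,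
      key hik hjk, key hjk hik, IH (b i) (b j) hP, IH (b i) ⁅b j, b k⁆ hP, IH (b j) ⁅b i, b k⁆ hP,
      IH ⁅b i, b j⁆ (b k) hP, ← J, map_sub, LinearMap.sub_apply, map_add]
    abel

/-- The Poincaré-Birkhoff-Witt representation of `L` on polynomials. -/
noncomputable def pbwRep : L →ₗ⁅K⁆ Module.End K (Multiset I →₀ K) where
  __ := pbwAct b
  map_lie' {x y} := by
    refine Finsupp.lhom_ext' fun M => LinearMap.ext_ring ?_
    have h := pbwAct_lie_of_monomial b (fun i j N _ => pbwAct_lie_monomial b i j N) x y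
      (pbwMonomial_mem_deg (K := K) (le_refl M.card))
    exact eq_sub_of_add_eq' h.symm

/-- Acting on the constant polynomial 1 sends each basis vector to its own variable, so the
coordinates of x are the coefficients of a linear polynomial. -/
theorem pbwRep_injective : Function.Injective (pbwRep b) := by
  have h : ((pbwAct b).flip (pbwMonomial K 0)) =
      (Finsupp.lmapDomain K K (fun i : I => ({i} : Multiset I))) ∘ₗ b.repr.toLinearMap :=
    b.ext fun i => by
      rw [LinearMap.flip_apply, pbwAct_of_le b i 0 (by simp)]
      simp [pbwMonomial]
  intro x y hxy
  refine b.repr.injective (Finsupp.mapDomain_injective (fun _ _ => Multiset.singleton_inj.1) ?_)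
  have := DFunLike.congr_fun hxy (pbwMonomial K 0)
  have h' := DFunLike.congr_fun h
  exact (h' x).symm.trans (this.trans (h' y))

end PBW

/-- A Lie algebra over a field embeds into its universal enveloping algebra. -/
theorem uea_ι_injective (K L : Type*) [Field K] [LieRing L] [LieAlgebra K L] :
    Function.Injective (UniversalEnvelopingAlgebra.ι K : L → UniversalEnvelopingAlgebra K L) := by
  let b := Module.Basis.ofVectorSpace K L
  -- Any linear order on the basis would do; a well-ordering supplies one.
  let : LinearOrder (Module.Basis.ofVectorSpaceIndex K L) := WellOrderingRel.isWellOrder.linearOrder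
  intro x y h
  apply pbwRep_injective b
  rw [← UniversalEnvelopingAlgebra.lift_ι_apply K (pbwRep b),
    ← UniversalEnvelopingAlgebra.lift_ι_apply K (pbwRep b), h]

/-! ### Primitive elements of the universal enveloping algebra -/

section Primitive

variable (K L : Type*) [Field K] [LieRing L] [LieAlgebra K L]

/-- The subspace `K + L` of `U(L)`. -/
noncomputable def ueaFil : Submodule K (UniversalEnvelopingAlgebra K L) :=
  1 ⊔ LinearMap.range (UniversalEnvelopingAlgebra.ι K : L →ₗ⁅K⁆ _).toLinearMap

/-- The degree filtration on `U(L) ⊗ U(L)`. -/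
noncomputable def ueaTensorFil (n : ℕ) :
    Submodule K (UniversalEnvelopingAlgebra K L ⊗[K] UniversalEnvelopingAlgebra K L) :=
  Submodule.span K {z | ∃ i j : ℕ, i + j = n ∧ ∃ p ∈ ueaFil K L ^ i, ∃ q ∈ ueaFil K L ^ j,
    z = p ⊗ₜ[K] q}

/-- The convolution square `u ↦ ∑ u₁ u₂` of the identity of `U(L)`. -/
noncomputable def ueaPsi : UniversalEnvelopingAlgebra K L →ₗ[K] UniversalEnvelopingAlgebra K L :=
  LinearMap.mul' K _ ∘ₗ Coalgebra.comul (R := K)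

variable {K L}

/-! ### The degree filtration and its compatibility with the coproduct -/

theorem one_le_ueaFil : (1 : Submodule K (UniversalEnvelopingAlgebra K L)) ≤ ueaFil K L :=
  le_sup_left

theorem ι_mem_ueaFil (X : L) : UniversalEnvelopingAlgebra.ι K X ∈ ueaFil K L :=
  le_sup_right (a := (1 : Submodule K (UniversalEnvelopingAlgebra K L))) ⟨X, rfl⟩

theorem ueaFil_mono {m n : ℕ} (h : m ≤ n) : ueaFil K L ^ m ≤ ueaFil K L ^ n :=
  pow_right_mono₀ one_le_ueaFil h

theorem ι_mul_mem_ueaFil (X : L) {n : ℕ} {u : UniversalEnvelopingAlgebra K L}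
    (hu : u ∈ ueaFil K L ^ n) : UniversalEnvelopingAlgebra.ι K X * u ∈ ueaFil K L ^ (n + 1) := by
  rw [pow_succ']
  exact Submodule.mul_mem_mul (ι_mem_ueaFil X) hu

/-- Induction along the degree filtration of `U(L)`. -/
theorem ueaFil_induction
    {p : ∀ (n : ℕ) (u : UniversalEnvelopingAlgebra K L), u ∈ ueaFil K L ^ n → Prop}
    (one : ∀ h, p 0 1 h) (add : ∀ n u v hu hv, p n u hu → p n v hv → p n (u + v) (add_mem hu hv))
    (smul : ∀ n (c : K) u hu, p n u hu → p n (c • u) (Submodule.smul_mem _ c hu))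
    (succ : ∀ n u hu, p n u hu → p (n + 1) u (ueaFil_mono n.le_succ hu))
    (mul : ∀ n X u hu, p n u hu →
      p (n + 1) (UniversalEnvelopingAlgebra.ι K X * u) (ι_mul_mem_ueaFil X hu))
    {n : ℕ} {u : UniversalEnvelopingAlgebra K L} (hu : u ∈ ueaFil K L ^ n) : p n u hu := by
  -- The membership proof is bundled into the goal, so that the inner induction on products can
  -- reassemble it.
  suffices H : ∃ h, p n u h from H.2
  induction n generalizing u with
  | zero =>
    have h1 : (1 : UniversalEnvelopingAlgebra K L) ∈ ueaFil K L ^ 0 := by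
      rw [pow_zero]; exact Submodule.one_le.1 le_rfl
    rw [pow_zero, Submodule.mem_one] at hu
    obtain ⟨c, rfl⟩ := hu
    rw [Algebra.algebraMap_eq_smul_one]
    exact ⟨_, smul 0 c 1 h1 (one h1)⟩
  | succ n ih =>
    rw [pow_succ'] at hu
    induction hu using Submodule.mul_induction_on' with
    | add u _ v _ hu hv => exact ⟨_, add _ u v _ _ hu.2 hv.2⟩
    | mem_mul_mem a ha v hv =>
      -- A factor in K + L splits into a scalar, which does not raise the degree, and an element of
      -- L, which the case `mul` handles.
      obtain ⟨a', ha', _, ⟨X, rfl⟩, rfl⟩ := Submodule.mem_sup.1 ha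
      obtain ⟨c, rfl⟩ := Submodule.mem_one.1 ha'
      rw [add_mul, ← Algebra.smul_def]
      exact ⟨_, add _ _ _ _ _ (smul _ c v _ (succ n v hv (ih hv).2)) (mul n X v hv (ih hv).2)⟩

theorem exists_mem_ueaFil (u : UniversalEnvelopingAlgebra K L) : ∃ n, u ∈ ueaFil K L ^ n := by
  let S : Subalgebra K (UniversalEnvelopingAlgebra K L) :=
    { carrier := {u | ∃ n, u ∈ ueaFil K L ^ n}
      mul_mem' := by
        rintro u v ⟨m, hm⟩ ⟨n, hn⟩
        exact ⟨m + n, pow_add (ueaFil K L) m n ▸ Submodule.mul_mem_mul hm hn⟩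
      add_mem' := by
        rintro u v ⟨m, hm⟩ ⟨n, hn⟩
        exact ⟨max m n, add_mem (ueaFil_mono (le_max_left m n) hm)
          (ueaFil_mono (le_max_right m n) hn)⟩
      algebraMap_mem' := fun c => ⟨0, by rw [pow_zero]; exact Submodule.mem_one.2 ⟨c, rfl⟩⟩ }
  exact uea_mem_subalgebra S (fun X => ⟨1, by rw [pow_one]; exact ι_mem_ueaFil X⟩) u

/-- Bracketing with X is a derivation that maps L to L: it alters one factor of a product at a time
and adds none. -/
theorem ι_lie_mem_ueaFil (X : L) {n : ℕ} {u : UniversalEnvelopingAlgebra K L}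
    (hu : u ∈ ueaFil K L ^ n) : ⁅UniversalEnvelopingAlgebra.ι K X, u⁆ ∈ ueaFil K L ^ n := by
  induction hu using ueaFil_induction with
  | one => rw [LieRing.of_associative_ring_bracket, mul_one, one_mul, sub_self]; exact zero_mem _
  | add n u v _ _ hu hv => rw [lie_add]; exact add_mem hu hv
  | smul n c u _ hu => 
    rw [LieRing.of_associative_ring_bracket] at hu ⊢
    rw [mul_smul_comm, smul_mul_assoc, ← smul_sub]
    exact Submodule.smul_mem _ c hu
  | succ n u _ hu => exact ueaFil_mono n.le_succ hu
  | mul n Y u hu h =>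
    have : ⁅UniversalEnvelopingAlgebra.ι K X, UniversalEnvelopingAlgebra.ι K Y * u⁆ =
        UniversalEnvelopingAlgebra.ι K ⁅X, Y⁆ * u +
          UniversalEnvelopingAlgebra.ι K Y * ⁅UniversalEnvelopingAlgebra.ι K X, u⁆ := by
      simp only [LieHom.map_lie, LieRing.of_associative_ring_bracket]
      noncomm_ring
    rw [this]
    exact add_mem (ι_mul_mem_ueaFil _ hu) (ι_mul_mem_ueaFil _ h)

theorem tmul_mem_ueaTensorFil {i j n : ℕ} (h : i + j = n) {p q : UniversalEnvelopingAlgebra K L}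
    (hp : p ∈ ueaFil K L ^ i) (hq : q ∈ ueaFil K L ^ j) : p ⊗ₜ[K] q ∈ ueaTensorFil K L n :=
  Submodule.subset_span ⟨i, j, h, p, hp, q, hq, rfl⟩

theorem ueaTensorFil_le {n : ℕ}
    {N : Submodule K (UniversalEnvelopingAlgebra K L ⊗[K] UniversalEnvelopingAlgebra K L)}
    (h : ∀ i j p q, i + j = n → p ∈ ueaFil K L ^ i → q ∈ ueaFil K L ^ j → p ⊗ₜ[K] q ∈ N) :
    ueaTensorFil K L n ≤ N := by
  refine Submodule.span_le.2 ?_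
  rintro _ ⟨i, j, hij, p, hp, q, hq, rfl⟩
  exact h i j p q hij hp hq

theorem comul_mem_ueaTensorFil {n : ℕ} {u : UniversalEnvelopingAlgebra K L}
    (hu : u ∈ ueaFil K L ^ n) : Coalgebra.comul (R := K) u ∈ ueaTensorFil K L n := by
  induction hu using ueaFil_induction with
  | one =>
    rw [Bialgebra.comul_one, Algebra.TensorProduct.one_def]
    exact tmul_mem_ueaTensorFil (i := 0) (j := 0) rfl
      (by rw [pow_zero]; exact Submodule.one_le.1 le_rfl)
      (by rw [pow_zero]; exact Submodule.one_le.1 le_rfl)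
  | add n u v _ _ hu hv => rw [map_add]; exact add_mem hu hv
  | smul n c u _ hu => rw [map_smul]; exact Submodule.smul_mem _ c hu
  | succ n u _ hu =>
    exact ueaTensorFil_le (fun i j p q h hp hq => tmul_mem_ueaTensorFil (i := i) (j := j + 1)
      (by omega) hp (ueaFil_mono j.le_succ hq)) hu
  | mul n X u _ h =>
    rw [Bialgebra.comul_mul, uea_comul_ι]
    refine ueaTensorFil_le (N := (ueaTensorFil K L (n + 1)).comap (LinearMap.mulLeft K _))
      (fun i j p q h hp hq => ?_) h
    rw [Submodule.mem_comap, LinearMap.mulLeft_apply, add_mul, Algebra.TensorProduct.tmul_mul_tmul,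
      Algebra.TensorProduct.tmul_mul_tmul, one_mul, one_mul]
    exact add_mem (tmul_mem_ueaTensorFil (by omega) (ι_mul_mem_ueaFil X hp) hq)
      (tmul_mem_ueaTensorFil (by omega) hp (ι_mul_mem_ueaFil X hq))

/-- The map `f` on the left leg lets one statement serve both Ψ, with `f` the identity, and the
commutator term of `ueaPsi_ι_mul`. -/
theorem mul_mem_of_ueaTensorFil {n : ℕ}
    (f : UniversalEnvelopingAlgebra K L →ₗ[K] UniversalEnvelopingAlgebra K L)
    (hf : ∀ i, ∀ u ∈ ueaFil K L ^ i, f u ∈ ueaFil K L ^ i)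
    {z : UniversalEnvelopingAlgebra K L ⊗[K] UniversalEnvelopingAlgebra K L}
    (hz : z ∈ ueaTensorFil K L n) :
    LinearMap.mul' K (UniversalEnvelopingAlgebra K L) (f.rTensor _ z) ∈ ueaFil K L ^ n := by
  refine ueaTensorFil_le (N := (ueaFil K L ^ n).comap (LinearMap.mul' K _ ∘ₗ f.rTensor _))
    (fun i j p q h hp hq => ?_) hz
  rw [Submodule.mem_comap, LinearMap.comp_apply, LinearMap.rTensor_tmul, LinearMap.mul'_apply, ← h,
    pow_add]
  exact Submodule.mul_mem_mul (hf i p hp) hq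

theorem ueaPsi_mem {n : ℕ} {u : UniversalEnvelopingAlgebra K L} (hu : u ∈ ueaFil K L ^ n) :
    ueaPsi K L u ∈ ueaFil K L ^ n := by
  have h := mul_mem_of_ueaTensorFil LinearMap.id (fun _ _ h => h) (comul_mem_ueaTensorFil hu)
  rwa [LinearMap.rTensor_id] at h

/-! ### The convolution square on successive quotients of the filtration -/

theorem ueaPsi_ι_mul (X : L) (u : UniversalEnvelopingAlgebra K L) :
    ueaPsi K L (UniversalEnvelopingAlgebra.ι K X * u) =
      (2 : K) • (UniversalEnvelopingAlgebra.ι K X * ueaPsi K L u) -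
        LinearMap.mul' K _ ((LieAlgebra.ad K (UniversalEnvelopingAlgebra K L)
          (UniversalEnvelopingAlgebra.ι K X)).rTensor _ (Coalgebra.comul (R := K) u)) := by
  simp only [ueaPsi, LinearMap.comp_apply, Bialgebra.comul_mul, uea_comul_ι]
  generalize Coalgebra.comul (R := K) u = z
  induction z using TensorProduct.induction_on with
  | zero => simp
  | add x y hx hy => simp only [mul_add, map_add, hx, hy, smul_add]; abel
  | tmul p q =>
    simp only [add_mul, Algebra.TensorProduct.tmul_mul_tmul, one_mul, map_add,
      LinearMap.mul'_apply, LinearMap.rTensor_tmul, LieAlgebra.ad_apply,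
      LieRing.of_associative_ring_bracket, two_smul]
    noncomm_ring

/-- By `ueaPsi_ι_mul` each new factor X contributes a factor 2, and the commutator term lies one
step below the top degree. Writing n = m + 1 rather than n - 1 makes degree zero vacuous. -/
theorem ueaPsi_sub_mem (n : ℕ) {u : UniversalEnvelopingAlgebra K L}
    (hu : u ∈ ueaFil K L ^ n) : ∀ m, n = m + 1 →
    ueaPsi K L u - (2 : K) ^ n • u ∈ ueaFil K L ^ m := by
  induction hu using ueaFil_induction with
  | one => intro m h; omega
  | add n u v _ _ hu hv =>
    intro m h
    convert add_mem (hu m h) (hv m h) using 1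
    rw [map_add, smul_add]
    abel
  | smul n c u _ hu =>
    intro m h
    convert Submodule.smul_mem _ c (hu m h) using 1
    rw [map_smul, smul_comm, smul_sub]
  | succ n u hu _ =>
    intro m h
    obtain rfl : n = m := by omega
    exact sub_mem (ueaPsi_mem hu) (Submodule.smul_mem _ _ hu)
  | mul n X u hu h =>
    intro m hm
    obtain rfl : n = m := by omega
    rw [ueaPsi_ι_mul, sub_right_comm, pow_succ', mul_smul, ← smul_sub, ← mul_smul_comm, ← mul_sub]
    refine sub_mem (Submodule.smul_mem _ _ ?_) (mul_mem_of_ueaTensorFil _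
      (fun i u hu => ι_lie_mem_ueaFil X hu) (comul_mem_ueaTensorFil hu))
    -- For n = 0 the induction hypothesis says nothing, but `u` is then a scalar, which Ψ fixes.
    rcases n with _ | n
    · rw [pow_zero] at hu
      obtain ⟨c, rfl⟩ := Submodule.mem_one.1 hu
      have : ueaPsi K L (algebraMap K _ c) = algebraMap K _ c := by
        rw [Algebra.algebraMap_eq_smul_one, map_smul, ueaPsi, LinearMap.comp_apply,
          Bialgebra.comul_one, Algebra.TensorProduct.one_def, LinearMap.mul'_apply, one_mul]
      rw [this, pow_zero, pow_zero, one_smul, sub_self, mul_zero]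
      exact zero_mem _
    · exact ι_mul_mem_ueaFil X (h n rfl)

/-- In characteristic zero the primitive elements of `U(L)` are the elements of `L`. -/
theorem exists_ι_eq_of_primitive [CharZero K] {u : UniversalEnvelopingAlgebra K L}
    (hu : Coalgebra.comul (R := K) u = u ⊗ₜ[K] 1 + 1 ⊗ₜ[K] u) :
    ∃ X : L, UniversalEnvelopingAlgebra.ι K X = u := by
  have hψ : ueaPsi K L u = (2 : K) • u := by
    rw [ueaPsi, LinearMap.comp_apply, hu, map_add, LinearMap.mul'_apply, LinearMap.mul'_apply,
      mul_one, one_mul, two_smul]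
  have h1 : ∀ n, u ∈ ueaFil K L ^ (n + 1) → u ∈ ueaFil K L := by
    intro n
    induction n with
    | zero => rw [zero_add, pow_one]; exact id
    | succ n ih =>
      intro h
      refine ih ?_
      -- Comparing the eigenvalue 2 with 2^(n+2) places (2 - 2^(n+2))u one step lower, and
      -- characteristic zero makes this scalar invertible.
      have h2 := ueaPsi_sub_mem _ h _ rfl
      rw [hψ, ← sub_smul] at h2
      refine (Submodule.smul_mem_iff _ ?_).1 h2
      have h3 : (2 : ℕ) ^ 1 < 2 ^ (n + 1 + 1) := Nat.pow_lt_pow_right (by norm_num) (by omega)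
      rw [sub_ne_zero]
      exact_mod_cast h3.ne
  obtain ⟨n, hn⟩ := exists_mem_ueaFil u
  obtain ⟨a, ha, _, ⟨X, rfl⟩, rfl⟩ := Submodule.mem_sup.1 (h1 n (ueaFil_mono n.le_succ hn))
  obtain ⟨c, rfl⟩ := Submodule.mem_one.1 ha
  -- Applying ε ⊗ ε to the primitivity equation gives c = c + c for the constant term c of `u`.
  have hε := congrArg (fun z => Coalgebra.counit (R := K)
    (TensorProduct.lid K _ ((Coalgebra.counit (R := K)).rTensor _ z))) hu
  simp [-UniversalEnvelopingAlgebra.ι_apply, Coalgebra.rTensor_counit_comul, uea_counit_ι] at hε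
  exact ⟨X, by simp [hε]⟩

end Primitive

/-! ### Primitive elements of `A ⊙ U(L) ⊙ A` -/

section CMPrimitive

variable {K A L : Type*} [Field K] [Ring A] [Algebra K A] [LieRing L] [LieAlgebra K L]
variable (ω : L →ₗ⁅K⁆ DerK K A) (f : A →ₗ[K] K)

/-- The map `a ⊗ u ⊗ b ↦ f(a) u ⊗ b`. -/
noncomputable def cmContractLeft : CM ω →ₗ[K] UniversalEnvelopingAlgebra K L ⊗[K] A :=
  (TensorProduct.lid K _).toLinearMap ∘ₗ f.rTensor _ ∘ₗ (toCM ω).symm.toLinearMap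

/-- The map `a ⊗ u ⊗ b ↦ a ⊗ f(b) u`. -/
noncomputable def cmContractRight : CM ω →ₗ[K] A ⊗[K] UniversalEnvelopingAlgebra K L :=
  ((TensorProduct.rid K _).toLinearMap ∘ₗ f.lTensor _).lTensor A ∘ₗ (toCM ω).symm.toLinearMap

/-- The map `a ⊗ u ⊗ b ↦ f(a) f(b) u`. -/
noncomputable def cmContract : CM ω →ₗ[K] UniversalEnvelopingAlgebra K L :=
  (TensorProduct.rid K _).toLinearMap ∘ₗ f.lTensor _ ∘ₗ cmContractLeft ω f

/-- The map `a ⊗ u ⊗ b ↦ f(a) ε(u) b`. -/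
noncomputable def cmContractCounitLeft : CM ω →ₗ[K] A :=
  (TensorProduct.lid K A).toLinearMap ∘ₗ (Coalgebra.counit (R := K)).rTensor A ∘ₗ
    cmContractLeft ω f

/-- The map `a ⊗ u ⊗ b ↦ f(b) ε(u) a`. -/
noncomputable def cmContractCounitRight : CM ω →ₗ[K] A :=
  (TensorProduct.rid K A).toLinearMap ∘ₗ (Coalgebra.counit (R := K)).lTensor A ∘ₗ
    cmContractRight ω f

/-- The map `(a ⊗ u ⊗ b) ⊗ (a' ⊗ u' ⊗ b') ↦ f(a) f(b a') f(b') u ⊗ u'`. -/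
noncomputable def cmContract₂ : CM ω ⊗[K] CM ω →ₗ[K]
    UniversalEnvelopingAlgebra K L ⊗[K] UniversalEnvelopingAlgebra K L :=
  ((TensorProduct.lid K _).toLinearMap ∘ₗ (f ∘ₗ LinearMap.mul' K A).rTensor _ ∘ₗ
      (TensorProduct.assoc K A A (UniversalEnvelopingAlgebra K L)).symm.toLinearMap).lTensor _ ∘ₗ
    (TensorProduct.assoc K (UniversalEnvelopingAlgebra K L) A _).toLinearMap ∘ₗ
    TensorProduct.map (cmContractLeft ω f) (cmContractRight ω f)

theorem cmContractLeft_elem (a b : A) (u : UniversalEnvelopingAlgebra K L) :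
    cmContractLeft ω f (cmElem ω a u b) = f a • (u ⊗ₜ[K] b) := rfl

theorem cmContractRight_elem (a b : A) (u : UniversalEnvelopingAlgebra K L) :
    cmContractRight ω f (cmElem ω a u b) = a ⊗ₜ[K] (f b • u) := rfl

theorem cmContract_elem (a b : A) (u : UniversalEnvelopingAlgebra K L) :
    cmContract ω f (cmElem ω a u b) = f a • f b • u := by
  simp [cmContract, cmContractLeft_elem]

theorem cmContractCounitLeft_elem (a b : A) (u : UniversalEnvelopingAlgebra K L) :
    cmContractCounitLeft ω f (cmElem ω a u b) = f a • Coalgebra.counit (R := K) u • b := by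
  simp [cmContractCounitLeft, cmContractLeft_elem]

theorem cmContractCounitRight_elem (a b : A) (u : UniversalEnvelopingAlgebra K L) :
    cmContractCounitRight ω f (cmElem ω a u b) = f b • Coalgebra.counit (R := K) u • a := by
  simp [cmContractCounitRight, cmContractRight_elem]

theorem cmContract₂_elem (a b a' b' : A) (u u' : UniversalEnvelopingAlgebra K L) :
    cmContract₂ ω f (cmElem ω a u b ⊗ₜ[K] cmElem ω a' u' b') =
      (f a * f (b * a') * f b') • (u ⊗ₜ[K] u') := by
  simp only [cmContract₂, LinearMap.comp_apply, TensorProduct.map_tmul, cmContractLeft_elem,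
    cmContractRight_elem, ← TensorProduct.smul_tmul', LinearEquiv.coe_coe, map_smul,
    TensorProduct.assoc_tmul, LinearMap.lTensor_tmul, TensorProduct.tmul_smul,
    TensorProduct.assoc_symm_tmul, LinearMap.rTensor_tmul, TensorProduct.lid_tmul,
    LinearMap.mul'_apply, smul_smul]
  congr 1
  ring

/-- The map `(a ⊗ u ⊗ b) ⊗ y ↦ s(f(a) ε(u) b) y`. -/
noncomputable def cmEvalLeft : CM ω ⊗[K] CM ω →ₗ[K] CM ω :=
  LinearMap.mul' K (CM ω) ∘ₗ ((cmS ω).toLinearMap ∘ₗ cmContractCounitLeft ω f).rTensor (CM ω)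

/-- The map `x ⊗ (a ⊗ u ⊗ b) ↦ t(f(b) ε(u) a) x`. -/
noncomputable def cmEvalRight : CM ω ⊗[K] CM ω →ₗ[K] CM ω :=
  LinearMap.mul' K (CM ω) ∘ₗ (TensorProduct.comm K (CM ω) (CM ω)).toLinearMap ∘ₗ
    ((cmT ω).toLinearMap ∘ₗ (MulOpposite.opLinearEquiv K).toLinearMap ∘ₗ
      cmContractCounitRight ω f).lTensor (CM ω)

theorem cmEvalLeft_tmul (x y : CM ω) :
    cmEvalLeft ω f (x ⊗ₜ[K] y) = cmS ω (cmContractCounitLeft ω f x) * y := rfl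

theorem cmEvalRight_tmul (x y : CM ω) :
    cmEvalRight ω f (x ⊗ₜ[K] y) = cmT ω (op (cmContractCounitRight ω f y)) * x := rfl

theorem cmS_mul_elem (c a b : A) (u : UniversalEnvelopingAlgebra K L) :
    cmS ω c * cmElem ω a u b = cmElem ω (c * a) u b := by
  rw [cmS_apply, cmElem_one_mul, mul_one]

theorem cmT_mul_elem (c a b : A) (u : UniversalEnvelopingAlgebra K L) :
    cmT ω (op c) * cmElem ω a u b = cmElem ω a u (b * c) := by
  rw [cmT_apply, cmElem_one_mul, one_mul]

theorem cmElem_smul_left (c : K) (a b : A) (u : UniversalEnvelopingAlgebra K L) :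
    cmElem ω (c • a) u b = c • cmElem ω a u b := rfl

theorem cmElem_smul_mid (c : K) (a b : A) (u : UniversalEnvelopingAlgebra K L) :
    cmElem ω a (c • u) b = c • cmElem ω a u b := (cmMid ω a b).map_smul c u

theorem cmElem_smul_right (c : K) (a b : A) (u : UniversalEnvelopingAlgebra K L) :
    cmElem ω a u (c • b) = c • cmElem ω a u b := by
  simp [cmElem]

/-! ### Contractions that descend to B ⊗_A B, evaluated on coproducts -/

theorem tensorRel_le_ker_cmEvalLeft :
    tensorRel (cmS ω) (cmT ω) ≤ LinearMap.ker (cmEvalLeft ω f) := by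
  refine Submodule.span_le.2 ?_
  rintro _ ⟨c, m, n, rfl⟩
  have h : cmContractCounitLeft ω f ∘ₗ LinearMap.mulLeft K (cmT ω (op c)) =
      LinearMap.mulRight K c ∘ₗ cmContractCounitLeft ω f :=
    cm_ext' ω fun a u b => by
      simp [cmT_mul_elem, cmContractCounitLeft_elem]
  have h' : cmContractCounitLeft ω f (cmT ω (op c) * m) = cmContractCounitLeft ω f m * c :=
    DFunLike.congr_fun h m
  rw [SetLike.mem_coe, LinearMap.mem_ker, map_sub, cmEvalLeft_tmul, cmEvalLeft_tmul, h', map_mul,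
    mul_assoc, sub_self]

/-- A factor s(c) on the second leg multiplies the contracted element by c on the left; the target
map reverses products, so t(c) ends up next to the first leg. -/
theorem tensorRel_le_ker_cmEvalRight :
    tensorRel (cmS ω) (cmT ω) ≤ LinearMap.ker (cmEvalRight ω f) := by
  refine Submodule.span_le.2 ?_
  rintro _ ⟨c, m, n, rfl⟩
  have h : cmContractCounitRight ω f ∘ₗ LinearMap.mulLeft K (cmS ω c) =
      LinearMap.mulLeft K c ∘ₗ cmContractCounitRight ω f :=
    cm_ext' ω fun a u b => by
      simp [cmS_mul_elem, cmContractCounitRight_elem]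
  have h' : cmContractCounitRight ω f (cmS ω c * n) = c * cmContractCounitRight ω f n :=
    DFunLike.congr_fun h n
  rw [SetLike.mem_coe, LinearMap.mem_ker, map_sub, cmEvalRight_tmul, cmEvalRight_tmul, h',
    MulOpposite.op_mul, map_mul, mul_assoc, sub_self]

/-- Both sides of a relation insert c between the inner ends, giving f(b c a'). This is why those
two ends are multiplied before f is applied. -/
theorem tensorRel_le_ker_cmContract₂ :
    tensorRel (cmS ω) (cmT ω) ≤ LinearMap.ker (cmContract₂ ω f) := by
  refine Submodule.span_le.2 ?_
  rintro _ ⟨c, m, n, rfl⟩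
  have h : TensorProduct.curry (cmContract₂ ω f) ∘ₗ LinearMap.mulLeft K (cmT ω (op c)) =
      (LinearMap.mulLeft K (cmS ω c)).lcomp K _ ∘ₗ TensorProduct.curry (cmContract₂ ω f) :=
    cm_ext' ω fun a u b => cm_ext' ω fun a' u' b' => by
      simp [cmT_mul_elem, cmS_mul_elem, cmContract₂_elem, mul_assoc]
  rw [SetLike.mem_coe, LinearMap.mem_ker, map_sub, sub_eq_zero]
  exact DFunLike.congr_fun (DFunLike.congr_fun h m) n

/-- Primitivity is only an equation modulo the balancing relations; a map killing them turns it into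
an honest equation for the representative `cmDRep`. -/
theorem apply_cmDRep_of_mem_prim {V : Type*} [AddCommGroup V] [Module K V]
    {g : CM ω ⊗[K] CM ω →ₗ[K] V} (hg : tensorRel (cmS ω) (cmT ω) ≤ LinearMap.ker g) {x : CM ω}
    (hx : x ∈ (cmBialgebroid ω).prim) : g (cmDRep ω x) = g (x ⊗ₜ[K] 1) + g (1 ⊗ₜ[K] x) := by
  have h := LinearMap.mem_ker.1 (hg ((cm_mkQ_eq ω).1 ((cmBialgebroid ω).mem_prim.1 hx)))
  rwa [map_sub, sub_eq_zero, map_add] at h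

/-- The map `a ⊗ u ⊗ b ↦ f(a) ⊗ u ⊗ b`. -/
noncomputable def cmProjLeft : CM ω →ₗ[K] CM ω :=
  (toCM ω).toLinearMap ∘ₗ TensorProduct.mk K A _ 1 ∘ₗ cmContractLeft ω f

/-- The map `a ⊗ u ⊗ b ↦ a ⊗ u ⊗ f(b)`. -/
noncomputable def cmProjRight : CM ω →ₗ[K] CM ω :=
  (toCM ω).toLinearMap ∘ₗ ((TensorProduct.mk K (UniversalEnvelopingAlgebra K L) A).flip
    1).lTensor A ∘ₗ cmContractRight ω f

theorem cmProjLeft_elem (a b : A) (u : UniversalEnvelopingAlgebra K L) :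
    cmProjLeft ω f (cmElem ω a u b) = f a • cmElem ω 1 u b := by
  simp only [cmProjLeft, LinearMap.comp_apply, cmContractLeft_elem, map_smul]
  rfl

theorem cmProjRight_elem (a b : A) (u : UniversalEnvelopingAlgebra K L) :
    cmProjRight ω f (cmElem ω a u b) = f b • cmElem ω a u 1 := by
  rw [← cmElem_smul_mid]
  rfl

/-- The counit law ∑ ε(u₁)u₂ = u of U(L) collapses the contracted coproduct. -/
theorem cmEvalLeft_cmDRep (x : CM ω) : cmEvalLeft ω f (cmDRep ω x) = cmProjLeft ω f x := by
  suffices h : cmEvalLeft ω f ∘ₗ cmDRep ω = cmProjLeft ω f from DFunLike.congr_fun h x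
  refine cm_ext' ω fun a u b => ?_
  have h : ∀ v : UniversalEnvelopingAlgebra K L ⊗[K] UniversalEnvelopingAlgebra K L,
      cmEvalLeft ω f (TensorProduct.map (cmMid ω a 1) (cmMid ω 1 b) v) =
        f a • cmMid ω 1 b (TensorProduct.lid K _ ((Coalgebra.counit (R := K)).rTensor _ v)) := by
    intro v
    induction v using TensorProduct.induction_on with
    | zero => simp
    | add x y hx hy => simp only [map_add, hx, hy, smul_add]
    | tmul p q =>
      simp only [TensorProduct.map_tmul, cmMid_apply, cmEvalLeft_tmul, cmContractCounitLeft_elem,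
        cmS_mul_elem, mul_one, LinearMap.rTensor_tmul, TensorProduct.lid_tmul, cmElem_smul_left,
        cmElem_smul_mid]
  rw [LinearMap.comp_apply, cmDRep_elem, h, Coalgebra.rTensor_counit_comul, cmProjLeft_elem]
  simp [cmMid_apply]

theorem cmEvalRight_cmDRep (x : CM ω) : cmEvalRight ω f (cmDRep ω x) = cmProjRight ω f x := by
  suffices h : cmEvalRight ω f ∘ₗ cmDRep ω = cmProjRight ω f from DFunLike.congr_fun h x
  refine cm_ext' ω fun a u b => ?_
  have h : ∀ v : UniversalEnvelopingAlgebra K L ⊗[K] UniversalEnvelopingAlgebra K L,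
      cmEvalRight ω f (TensorProduct.map (cmMid ω a 1) (cmMid ω 1 b) v) =
        f b • cmMid ω a 1 (TensorProduct.rid K _ ((Coalgebra.counit (R := K)).lTensor _ v)) := by
    intro v
    induction v using TensorProduct.induction_on with
    | zero => simp
    | add x y hx hy => simp only [map_add, hx, hy, smul_add]
    | tmul p q =>
      simp only [TensorProduct.map_tmul, cmMid_apply, cmEvalRight_tmul, cmContractCounitRight_elem,
        cmT_mul_elem, one_mul, LinearMap.lTensor_tmul, TensorProduct.rid_tmul, cmElem_smul_right,
        cmElem_smul_mid]
  rw [LinearMap.comp_apply, cmDRep_elem, h, Coalgebra.lTensor_counit_comul, cmProjRight_elem]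
  simp [cmMid_apply]

theorem cmContract₂_cmDRep_J (hf : f 1 = 1) (u : UniversalEnvelopingAlgebra K L) :
    cmContract₂ ω f (cmDRep ω (cmJ ω u)) = Coalgebra.comul (R := K) u := by
  rw [cmJ_apply, cmDRep_elem]
  generalize Coalgebra.comul (R := K) u = v
  induction v using TensorProduct.induction_on with
  | zero => simp
  | add x y hx hy => simp only [map_add, hx, hy]
  | tmul p q => simp [cmMid_apply, cmContract₂_elem, hf]

theorem cmProjRight_cmProjLeft (x : CM ω) :
    cmProjRight ω f (cmProjLeft ω f x) = cmJ ω (cmContract ω f x) := by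
  suffices h : cmProjRight ω f ∘ₗ cmProjLeft ω f = (cmJ ω).toLinearMap ∘ₗ cmContract ω f from
    DFunLike.congr_fun h x
  refine cm_ext' ω fun a u b => ?_
  simp only [LinearMap.comp_apply, cmProjLeft_elem, map_smul, cmProjRight_elem, cmContract_elem]
  rfl

/-- If `1 ⊗ u ⊗ 1` is primitive, so is `u`. -/
theorem comul_of_cmJ_mem_prim (hf : f 1 = 1) {u : UniversalEnvelopingAlgebra K L}
    (hu : cmJ ω u ∈ (cmBialgebroid ω).prim) :
    Coalgebra.comul (R := K) u = u ⊗ₜ[K] 1 + 1 ⊗ₜ[K] u := by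
  have h := apply_cmDRep_of_mem_prim ω (tensorRel_le_ker_cmContract₂ ω f) hu
  rw [cmContract₂_cmDRep_J ω f hf, ← map_one (cmJ ω), cmJ_apply, cmJ_apply, cmContract₂_elem,
    cmContract₂_elem] at h
  simpa [hf] using h

/-- A primitive element differs from some `1 ⊗ v ⊗ 1` by some `s(a) - t(a)`. -/
theorem exists_eq_of_mem_prim (hf : f 1 = 1) {x : CM ω} (hx : x ∈ (cmBialgebroid ω).prim) :
    ∃ (v : UniversalEnvelopingAlgebra K L) (a : A), x = cmJ ω v + (cmS ω a - cmT ω (op a)) := by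
  have h1 := apply_cmDRep_of_mem_prim ω (tensorRel_le_ker_cmEvalLeft ω f) hx
  have h2 := apply_cmDRep_of_mem_prim ω (tensorRel_le_ker_cmEvalRight ω f) hx
  have hl : cmContractCounitLeft ω f 1 = 1 := by
    rw [← map_one (cmJ ω), cmJ_apply, cmContractCounitLeft_elem]
    simp [hf]
  have hr : cmContractCounitRight ω f 1 = 1 := by
    rw [← map_one (cmJ ω), cmJ_apply, cmContractCounitRight_elem]
    simp [hf]
  rw [cmEvalLeft_cmDRep, cmEvalLeft_tmul, cmEvalLeft_tmul, hl, map_one, mul_one, one_mul] at h1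
  rw [cmEvalRight_cmDRep, cmEvalRight_tmul, cmEvalRight_tmul, hr, MulOpposite.op_one, map_one,
    mul_one, one_mul] at h2
  -- Projecting the remaining end of the left equation and inserting the right one gives 1 ⊗ u ⊗ 1 =
  -- s(p) + x + t(q).
  have h3 := congrArg (cmProjRight ω f) h1
  rw [cmProjRight_cmProjLeft, map_add, cmS_apply, cmProjRight_elem, hf, one_smul, ← cmS_apply,
    h2] at h3
  set p := cmContractCounitLeft ω f x
  set q := cmContractCounitRight ω f x
  set u := cmContract ω f x
  -- The counit vanishes on `x`, so ε(u)1 = p + q. This eliminates `p` and leaves `q` as the element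
  -- of A, with the constant ε(u) removed from `u`.
  have hε := congrArg (cmε ω) h3
  have hx0 : cmε ω x = 0 := (cmBialgebroid ω).ε_prim hx
  rw [map_add, map_add, cmε_s, cmε_t, hx0, zero_add, cmJ_apply, cmε_elem, one_mul] at hε
  have hs := congrArg (cmS ω) hε
  rw [map_add, map_smul, map_one] at hs
  refine ⟨u - Coalgebra.counit (R := K) u • 1, q, ?_⟩
  rw [map_sub, map_smul, map_one, hs, h3]
  abel

/-- The Lie algebra map `(X, y) ↦ 1 ⊗ X ⊗ 1 + y`. -/
noncomputable def cmSemidirectHom :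
    LieAlgebra.SemiDirectSum (cmBialgebroid ω).stIdeal L (cmδ ω) →ₗ⁅K⁆ (cmBialgebroid ω).prim where
  toFun z := cmγ ω z.right + z.left
  map_add' z w := by
    simp only [LieAlgebra.SemiDirectSum.add_eq_mk, map_add, LieSubmodule.coe_add]
    abel
  map_smul' c z := by simp [LieAlgebra.SemiDirectSum.smul_eq_mk]
  map_lie' {z w} := by
    have h : ∀ (X : L) (y : (cmBialgebroid ω).stIdeal),
        ((cmδ ω X y : (cmBialgebroid ω).stIdeal) : (cmBialgebroid ω).prim) =
          ⁅cmγ ω X, (y : (cmBialgebroid ω).prim)⁆ := fun _ _ => rfl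
    have h' : ∀ y y' : (cmBialgebroid ω).stIdeal, ((⁅y, y'⁆ : (cmBialgebroid ω).stIdeal) :
        (cmBialgebroid ω).prim) = ⁅(y : (cmBialgebroid ω).prim), (y' : (cmBialgebroid ω).prim)⁆ :=
      fun _ _ => rfl
    simp only [LieAlgebra.SemiDirectSum.lie_eq_mk, LieHom.map_lie, add_lie, lie_add,
      LieSubmodule.coe_add, LieSubmodule.coe_sub, h, h']
    -- The semi-direct bracket contains -δ(X')(y), while the commutator of the images contains ⁅y,
    -- γ(X')⁆.
    rw [← lie_skew (z.left : (cmBialgebroid ω).prim) (cmγ ω w.right)]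
    abel

theorem cmSemidirectHom_apply
    (z : LieAlgebra.SemiDirectSum (cmBialgebroid ω).stIdeal L (cmδ ω)) :
    cmSemidirectHom ω z = cmγ ω z.right + z.left := rfl

theorem coe_cmSemidirectHom
    (z : LieAlgebra.SemiDirectSum (cmBialgebroid ω).stIdeal L (cmδ ω)) :
    (cmSemidirectHom ω z : CM ω) = cmElem ω 1 (UniversalEnvelopingAlgebra.ι K z.right) 1 +
      ((z.left : (cmBialgebroid ω).prim) : CM ω) := rfl

/-- Contracting with f at both ends turns s(a) - t(a) into f(a) - f(a) = 0, so a vanishing sum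
forces X to vanish in U(L), hence in L; then y vanishes too. -/
theorem cmSemidirectHom_injective (hf : f 1 = 1) : Function.Injective (cmSemidirectHom ω) := by
  refine (injective_iff_map_eq_zero _).2 fun z hz => ?_
  obtain ⟨y, X⟩ := z
  obtain ⟨a, ha⟩ := y.2
  have h : cmElem ω 1 (UniversalEnvelopingAlgebra.ι K X) 1 +
      (cmElem ω a 1 1 - cmElem ω 1 1 a) = 0 := by
    have := congrArg (Subtype.val) hz
    rw [coe_cmSemidirectHom, ha] at this
    exact this
  have hX := congrArg (cmContract ω f) h
  rw [map_add, map_sub, cmContract_elem, cmContract_elem, cmContract_elem, hf, one_smul, one_smul,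
    one_smul, one_smul, sub_self, add_zero, map_zero] at hX
  obtain rfl : X = 0 := uea_ι_injective K L (by rw [hX, map_zero])
  rw [cmSemidirectHom_apply, map_zero, zero_add] at hz
  exact LieAlgebra.SemiDirectSum.ext (Subtype.ext hz) rfl

/-- Every s(a) - t(a) is primitive, so subtracting it from `x` leaves a primitive 1 ⊗ v ⊗ 1, whose
middle factor is primitive in U(L) and thus comes from L. -/
theorem cmSemidirectHom_surjective [CharZero K] (hf : f 1 = 1) :
    Function.Surjective (cmSemidirectHom ω) := by
  rintro ⟨x, hx⟩
  obtain ⟨v, a, rfl⟩ := exists_eq_of_mem_prim ω f hf hx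
  have ha : cmS ω a - cmT ω (op a) ∈ (cmBialgebroid ω).prim :=
    (cmBialgebroid ω).s_sub_t_mem_prim a
  have hv : cmJ ω v ∈ (cmBialgebroid ω).prim := by
    rw [← add_sub_cancel_right (cmJ ω v) (cmS ω a - cmT ω (op a))]
    exact sub_mem hx ha
  obtain ⟨X, rfl⟩ := exists_ι_eq_of_primitive (comul_of_cmJ_mem_prim ω f hf hv)
  exact ⟨⟨⟨⟨_, ha⟩, a, rfl⟩, X⟩, rfl⟩

end CMPrimitive

theorem mainTheorem7 {K A L : Type*} [Field K] [CharZero K] [Ring A] [Algebra K A] [Nontrivial A]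
    [LieRing L] [LieAlgebra K L] (ω : L →ₗ⁅K⁆ DerK K A) :
    ∃ e : LieAlgebra.SemiDirectSum (cmBialgebroid ω).stIdeal L (cmδ ω) ≃ₗ⁅K⁆
        (cmBialgebroid ω).prim,
      (∀ z, (cmBialgebroid ω).primAnchor (e z) = cmSemidirectAnchor ω z) ∧
      ∀ z, (e z : CM ω) = cmElem ω 1 (UniversalEnvelopingAlgebra.ι K z.right) 1 +
        ((z.left : (cmBialgebroid ω).prim) : CM ω) := by
  -- Over a field, the nonzero vector 1 of A takes the value 1 under some linear functional.
  obtain ⟨f, hf⟩ := Module.Projective.exists_dual_eq_one K (one_ne_zero : (1 : A) ≠ 0)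
  refine ⟨LieEquiv.ofBijective (cmSemidirectHom ω)
    ⟨cmSemidirectHom_injective ω f hf, cmSemidirectHom_surjective ω f hf⟩,
    fun z => ?_, fun z => rfl⟩
  change (cmBialgebroid ω).primAnchor (cmγ ω z.right + z.left) = _
  rw [map_add, cmγ_anchor]
  rfl
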